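/- An \emph{economy} consists of a finite set $I$ of agents, a finite set $O$ of objects, for every agent $i$ a strict linear order $\succ_i$ on $O\cup\{o^*\}$ ($o^*$ is the null object), and for every object $o$ a nonempty set $C_o\subseteq I$ of owners. It is a \emph{private-public-ownership} economy if for every $o\in O$ either $|C_o|=1$ or $C_o=I$. An \emph{allocation} is a map $\mu:I\to O\cup\{o^*\}$ with $|\mu^{-1}(o)|\le 1$ for every $o\in O$. A \emph{coalition} is a nonempty set of agents. Write $a\succsim_i b$ if $a=b$ or $a\succ_i b$, and $\omega(C)=\{o\in O: C_o\subseteq C\}$. A coalition $C$ is \emph{self-enforcing} in $\sigma$ if $\sigma(C)\subseteq\omega(C)\cup\{o^*\}$, and \emph{minimal self-enforcing} if moreover no coalition $C'\subsetneq C$ is self-enforcing in $\sigma$. Let $C_{\sigma=\mu}=\{i\in C:\sigma(i)=\mu(i)\}$. Let $\Omega(C|\mu)=\omega(\bigcup_{k\ge 0}C^k)$, where $C^0=C$ and $C^{k}=C^{k-1}\cup\mu^{-1}(\omega(C^{k-1}))$. Each of the following cores is the set of allocations $\mu$ for which there are no coalition $C$ and allocation $\sigma$ with the stated properties. \emph{Strong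 core:} (1) $\sigma(i)\succsim_i\mu(i)$ for all $i\in C$ and $\sigma(j)\succ_j\mu(j)$ for some $j\in C$; (2) $C$ is self-enforcing in $\sigma$. \emph{Rectified core:} (1), (2), and (3) for every coalition $C'\subseteq C_{\sigma=\mu}$ that is self-enforcing in $\sigma$ and every $i\in C\setminus C'$, if $\sigma(i)\in\omega(C')$ then $\sigma(i)\notin\mu(I\setminus C)$. \emph{Exclusion core:} $\sigma(i)\succ_i\mu(i)$ for all $i\in C$, and for every agent $j$, $\mu(j)\succ_j\sigma(j)$ implies $\mu(j)\in\Omega(C|\mu)$. \emph{Refined exclusion core:} (1); for every agent $j$, $\mu(j)\succ_j\sigma(j)$ implies $\mu(j)\in\Omega(C|\mu)$; and if $C_{\sigma=\mu}\ne\emptyset$, then either (a) $C_{\sigma=\mu}$ is self-enforcing in $\sigma$ and, for every agent $j$, $\mu(j)\succ_j\sigma(j)$ implies $\mu(j)\notin\Omega(C_{\sigma=\mu}|\mu)$, or (b) $C$ is minimal self-enforcing in $\sigma$. The \emph{YRMH-IGYT} (``you request my house -- I get your turn'') \emph{outcomes} are the allocations found by the following algorithm for some fixed linear order $\rhd$ of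 the agents. Initially the current order is $\rhd$, every object points to its $\rhd$-highest owner, and nobody has shared ownership of any object. In every step, keep the arcs between remaining agents and remaining objects. Every remaining object whose agent has been removed then points to its $\rhd$-highest remaining owner if there is one, otherwise to the $\rhd$-highest remaining agent with shared ownership of it if there is one, and otherwise to nobody. Let the first agent $i$ of the current order point to her favorite $o$ among the remaining objects and $o^*$. If $o=o^*$ or $o$ points to nobody, $i$ obtains $o$, and $i$ (and $o$, if $o\ne o^*$) are removed. If $o$ points to an agent and $i$ lies on a cycle of arcs, every agent of the cycle obtains the object she points to, and the agents and objects of the cycle are removed; moreover, whenever an agent of the cycle is an owner or shared owner of a remaining object $a$, every remaining agent who is an owner or shared owner of some object of the cycle, but not of $a$, obtains shared ownership of $a$. If $o$ points to an agent and no cycle forms, that agent is moved to the top of the current order. The algorithm ends when no agent remains. \textbf{Proposition.} In every private-public-ownership economy, the set of YRMH-IGYT outcomes, the refined exclusion core and the exclusion core are equal, and they are contained in the rectified core. None of these four sets need equal the strong core, even when the strong core is nonempty: there is a private-public-ownership economy whose strong core is nonempty and differs from each of the four. -/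

import Mathlib

universe u v

/-- An economy with complex endowments. Agents are the elements of `I`, objects the elements
of `O`; the null object is `none : Option O`. `pref i a b` says that agent `i` strictly prefers
`a` to `b`. Every object has a nonempty set of owners. -/
structure Economy (I : Type u) (O : Type v) where
  pref : I → Option O → Option O → Prop
  pref_strictTotal : ∀ i, IsStrictTotalOrder (Option O) (pref i)
  owners : O → Set I
  owners_nonempty : ∀ o, (owners o).Nonempty

namespace Economy

variable {I : Type u} {O : Type v}

/-- `b` is weakly worse than `a` for agent `i`. -/
def weakPref (E : Economy I O) (i : I) (a b : Option O) : Prop :=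
  a = b ∨ E.pref i a b

/-- Every object is owned privately (by one agent) or publicly (by all agents). -/
def PrivatePublic (E : Economy I O) : Prop :=
  ∀ o, (∃ i, E.owners o = {i}) ∨ E.owners o = Set.univ

/-- An allocation gives every agent one object or the null object, and no (real) object goes to
two agents. Objects may stay unassigned. -/
def IsAllocation (μ : I → Option O) : Prop :=
  ∀ i j o, μ i = some o → μ j = some o → i = j

/-- The endowments of a set `C` of agents: all objects whose owners all belong to `C`. -/
def endow (E : Economy I O) (C : Set I) : Set O :=
  {o | E.owners o ⊆ C}

/-- `C` is self-enforcing in `σ`: the assignments of `C` are endowments of `C` or null. -/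
def SelfEnforcing (E : Economy I O) (σ : I → Option O) (C : Set I) : Prop :=
  ∀ i ∈ C, ∀ o, σ i = some o → o ∈ E.endow C

/-- `C` is self-enforcing in `σ`, and no coalition that is a proper subset of `C` is. -/
def MinimalSelfEnforcing (E : Economy I O) (σ : I → Option O) (C : Set I) : Prop :=
  E.SelfEnforcing σ C ∧ ∀ C' : Set I, C'.Nonempty → C' ⊂ C → ¬ E.SelfEnforcing σ C'

/-- The members of `C` who are unaffected when moving from `μ` to `σ`. -/
def unaffected (C : Set I) (σ μ : I → Option O) : Set I :=
  {i ∈ C | σ i = μ i}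

/-- Nobody in `C` is worse off in `σ` than in `μ`, and somebody in `C` is better off. -/
def WeaklyImproves (E : Economy I O) (C : Set I) (σ μ : I → Option O) : Prop :=
  (∀ i ∈ C, E.weakPref i (σ i) (μ i)) ∧ ∃ j ∈ C, E.pref j (σ j) (μ j)

/-! ### Strong core and rectified core -/

def WeaklyBlocks (E : Economy I O) (C : Set I) (σ μ : I → Option O) : Prop :=
  E.WeaklyImproves C σ μ ∧ E.SelfEnforcing σ C

def strongCore (E : Economy I O) : Set (I → Option O) :=
  {μ | IsAllocation μ ∧ ¬ ∃ (C : Set I) (σ : I → Option O),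
    C.Nonempty ∧ IsAllocation σ ∧ E.WeaklyBlocks C σ μ}

def RectificationBlocks (E : Economy I O) (C : Set I) (σ μ : I → Option O) : Prop :=
  E.WeaklyImproves C σ μ ∧
  E.SelfEnforcing σ C ∧
  ∀ C' : Set I, C'.Nonempty → C' ⊆ unaffected C σ μ → E.SelfEnforcing σ C' →
    ∀ i ∈ C \ C', ∀ o, σ i = some o → o ∈ E.endow C' → ¬ ∃ k, k ∉ C ∧ μ k = some o

def rectifiedCore (E : Economy I O) : Set (I → Option O) :=
  {μ | IsAllocation μ ∧ ¬ ∃ (C : Set I) (σ : I → Option O),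
    C.Nonempty ∧ IsAllocation σ ∧ E.RectificationBlocks C σ μ}

/-! ### Exclusion core and refined exclusion core -/

/-- `C⁰ = C`, and `Cᵏ⁺¹` adds to `Cᵏ` the agents who occupy endowments of `Cᵏ` in `μ`. -/
def controlStep (E : Economy I O) (μ : I → Option O) (C : Set I) : ℕ → Set I
  | 0 => C
  | k + 1 => E.controlStep μ C k ∪ {j | ∃ o ∈ E.endow (E.controlStep μ C k), μ j = some o}

/-- The objects that `C` controls directly or indirectly in `μ`. -/
def control (E : Economy I O) (μ : I → Option O) (C : Set I) : Set O :=
  E.endow (⋃ k, E.controlStep μ C k)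

def ExclusionBlocks (E : Economy I O) (C : Set I) (σ μ : I → Option O) : Prop :=
  (∀ i ∈ C, E.pref i (σ i) (μ i)) ∧
  ∀ j, E.pref j (μ j) (σ j) → ∃ o ∈ E.control μ C, μ j = some o

def exclusionCore (E : Economy I O) : Set (I → Option O) :=
  {μ | IsAllocation μ ∧ ¬ ∃ (C : Set I) (σ : I → Option O),
    C.Nonempty ∧ IsAllocation σ ∧ E.ExclusionBlocks C σ μ}

def RefinedExclusionBlocks (E : Economy I O) (C : Set I) (σ μ : I → Option O) : Prop :=
  E.WeaklyImproves C σ μ ∧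
  (∀ j, E.pref j (μ j) (σ j) → ∃ o ∈ E.control μ C, μ j = some o) ∧
  ((unaffected C σ μ).Nonempty →
    (E.SelfEnforcing σ (unaffected C σ μ) ∧
      ∀ j, E.pref j (μ j) (σ j) → ¬ ∃ o ∈ E.control μ (unaffected C σ μ), μ j = some o) ∨
    E.MinimalSelfEnforcing σ C)

def refinedExclusionCore (E : Economy I O) : Set (I → Option O) :=
  {μ | IsAllocation μ ∧ ¬ ∃ (C : Set I) (σ : I → Option O),
    C.Nonempty ∧ IsAllocation σ ∧ E.RefinedExclusionBlocks C σ μ}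

/-! ### The mechanism "you request my house - I get your turn" -/

/-- A state of the algorithm between two steps: the remaining agents in their current order
(highest first), the remaining objects, the arcs from agents to objects and from objects to
agents, the agents who have obtained shared ownership of an object, and the assignments made so
far (`none` for agents without an assignment yet). -/
structure YState (I : Type u) (O : Type v) where
  order : List I
  objs : Set O
  agentArc : I → Option O
  objArc : O → Option I
  shared : O → Set I
  result : I → Option O

open Classical in
/-- The highest member of `X` in the list `r` (highest first), if there is one. -/
noncomputable def highest (r : List I) (X : Set I) : Option I :=
  r.find? (fun i => decide (i ∈ X))

/-- The initial state for the fixed order `r`: every object points to its highest owner. -/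
noncomputable def yInit (E : Economy I O) (r : List I) : YState I O where
  order := r
  objs := Set.univ
  agentArc := fun _ => none
  objArc := fun o => highest r (E.owners o)
  shared := fun _ => ∅
  result := fun _ => none

/-- The remaining owners of `o`. -/
def remOwners (E : Economy I O) (s : YState I O) (o : O) : Set I :=
  {i | i ∈ s.order ∧ i ∈ E.owners o}

/-- The remaining shared owners of `o`. -/
def remShared (s : YState I O) (o : O) : Set I :=
  {i | i ∈ s.order ∧ i ∈ s.shared o}

open Classical in
/-- The beginning of a step: arcs between remaining agents and remaining objects are kept; an
object whose agent has been removed points to its highest remaining owner in the fixed order `r`,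
if there is none to its highest remaining shared owner, and if there is none to nobody. -/
noncomputable def refresh (E : Economy I O) (r : List I) (s : YState I O) : YState I O :=
  { s with
    agentArc := fun j => if j ∈ s.order ∧ ∃ o ∈ s.objs, s.agentArc j = some o
      then s.agentArc j else none
    objArc := fun o => if ∃ k, s.objArc o = some k ∧ k ∉ s.order then
        (if (E.remOwners s o).Nonempty then highest r (E.remOwners s o)
          else highest r (remShared s o))
      else s.objArc o }

/-- `x` is the favorite of agent `i` among the objects in `A` and the null object. -/
def IsFavorite (E : Economy I O) (i : I) (A : Set O) (x : Option O) : Prop :=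
  (∀ o, x = some o → o ∈ A) ∧
  ∀ y : Option O, (∀ o, y = some o → o ∈ A) → y ≠ x → E.pref i x y

open Classical in
/-- Agent `i` points to the object `o`. -/
noncomputable def pointTo (s : YState I O) (i : I) (o : O) : YState I O :=
  { s with agentArc := Function.update s.agentArc i (some o) }

/-- `j` points to an object that points to `k`. -/
def link (s : YState I O) (j k : I) : Prop :=
  ∃ o, s.agentArc j = some o ∧ s.objArc o = some k

/-- The agents in the cycle through `i` (empty if there is no such cycle). -/
def cycleAgents (s : YState I O) (i : I) : Set I :=
  {j | Relation.TransGen (link s) i j ∧ Relation.TransGen (link s) j i}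

/-- The objects in the cycle through `i`. -/
def cycleObjs (s : YState I O) (i : I) : Set O :=
  {o | ∃ j ∈ cycleAgents s i, s.agentArc j = some o}

open Classical in
/-- Agent `i` obtains `x` (an object or the null object) and is removed, with the object. -/
noncomputable def removeSingle (s : YState I O) (i : I) (x : Option O) : YState I O :=
  { s with
    order := s.order.filter (fun j => decide (j ≠ i))
    objs := {o ∈ s.objs | x ≠ some o}
    result := Function.update s.result i x }

open Classical in
/-- The agents in the cycle through `i` obtain the objects they point to and are removed with
them. If an agent of the cycle is a (shared) owner of a remaining object `a`, every remaining
(shared) owner of an object of the cycle obtains shared ownership of `a`, unless she is a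
(shared) owner of `a` already. -/
noncomputable def removeCycle (E : Economy I O) (s : YState I O) (i : I) : YState I O :=
  { s with
    order := s.order.filter (fun j => decide (j ∉ cycleAgents s i))
    objs := s.objs \ cycleObjs s i
    shared := fun a => s.shared a ∪
      {j' | a ∈ s.objs \ cycleObjs s i ∧ j' ∉ cycleAgents s i ∧
        (∃ j ∈ cycleAgents s i, j ∈ E.remOwners s a ∪ remShared s a) ∧
        (∃ b ∈ cycleObjs s i, j' ∈ E.remOwners s b ∪ remShared s b) ∧
        j' ∉ E.remOwners s a ∪ remShared s a}
    result := fun j => if j ∈ cycleAgents s i then s.agentArc j else s.result j }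

open Classical in
/-- Agent `k` is moved to the top of the current order. -/
noncomputable def moveTop (s : YState I O) (k : I) : YState I O :=
  { s with order := k :: s.order.filter (fun j => decide (j ≠ k)) }

/-- What the highest agent `i` of the current order does, the arcs being up to date. -/
inductive YAct (E : Economy I O) : YState I O → YState I O → Prop
  /-- Her favorite is the null object: she obtains it. -/
  | null (s : YState I O) (i : I) (hi : s.order.head? = some i)
      (hx : E.IsFavorite i s.objs none) :
      YAct E s (removeSingle s i none)
  /-- Her favorite object does not point to any agent: she obtains it. -/
  | direct (s : YState I O) (i : I) (o : O) (hi : s.order.head? = some i)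
      (hx : E.IsFavorite i s.objs (some o)) (ho : s.objArc o = none) :
      YAct E s (removeSingle s i (some o))
  /-- Her favorite object points to an agent and a cycle forms: the cycle is carried out. -/
  | cycle (s : YState I O) (i : I) (o : O) (hi : s.order.head? = some i)
      (hx : E.IsFavorite i s.objs (some o)) (ho : s.objArc o ≠ none)
      (hc : i ∈ cycleAgents (pointTo s i o) i) :
      YAct E s (E.removeCycle (pointTo s i o) i)
  /-- Her favorite object points to the agent `k` and no cycle forms: `k` moves to the top. -/
  | move (s : YState I O) (i : I) (o : O) (k : I) (hi : s.order.head? = some i)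
      (hx : E.IsFavorite i s.objs (some o)) (ho : s.objArc o = some k)
      (hc : i ∉ cycleAgents (pointTo s i o) i) :
      YAct E s (moveTop (pointTo s i o) k)

/-- One step of the algorithm with fixed order `r`. -/
def YStep (E : Economy I O) (r : List I) (s s' : YState I O) : Prop :=
  YAct E (E.refresh r s) s'

/-- The outcomes of the mechanism: the allocations that are found, for some linear order `r` of
all agents, when no agent remains. -/
def yrmhOutcomes (E : Economy I O) : Set (I → Option O) :=
  {μ | ∃ r : List I, r.Nodup ∧ (∀ i, i ∈ r) ∧
    ∃ s : YState I O, Relation.ReflTransGen (E.YStep r) (E.yInit r) s ∧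
      s.order = [] ∧ s.result = μ}

end Economy

namespace Economy

variable {I : Type u} {O : Type v}

/-! The equalities come from a circle of inclusions: YRMH-IGYT outcomes lie in the refined exclusion
core, this lies in the exclusion core, and every allocation in the exclusion core is an outcome.

For the first inclusion, rank the agents by the time of their removal. Everybody obtains a favorite
among what remains, so an envied object left strictly earlier. An object with a remaining private
owner points to her, so the owner leaves no later than the occupant. These two facts form
`IsRanking` (`exists_isRanking_of_mem_yrmhOutcomes`), and they already exclude blocking. The first
improver takes an object from an earlier agent `j` outside the coalition. The blocking conditions
make that object private with an owner who is controlled by, or belongs to, the coalition. She is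
ranked before the first improver, and the coalition members ranked there are unaffected, which
contradicts the last clause of a refined block (`IsRanking.mem_refinedExclusionCore`) or of a
rectification block (`IsRanking.mem_rectifiedCore`).

For the return inclusion, let every remaining agent look at the private owner, or else the holder,
of her favorite remaining object. If somebody on the resulting cycle does not hold her favorite,
those agents exclusion-block. Hence a group can leave with its assignments, and repetition
decomposes the allocation (`exists_single_or_cycle`, `exists_decomposition`). With the departure
order as the fixed order of the algorithm, `Decomposition.exists_run` replays the groups; the point
is that shared ownership never disturbs them.

An economy with four agents and two objects separates all four sets from the strong core. -/

theorem pref_irrefl (E : Economy I O) (i : I) (a : Option O) : ¬ E.pref i a a :=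
  have := E.pref_strictTotal i
  irrefl_of (E.pref i) a

theorem pref_asymm (E : Economy I O) {i : I} {a b : Option O} (h : E.pref i a b) :
    ¬ E.pref i b a :=
  have := E.pref_strictTotal i
  asymm_of (E.pref i) h

theorem pref_total (E : Economy I O) (i : I) {a b : Option O} (h : a ≠ b) :
    E.pref i a b ∨ E.pref i b a := by
  have := E.pref_strictTotal i
  rcases trichotomous_of (E.pref i) a b with h1 | h1 | h1
  · exact Or.inl h1
  · exact absurd h1 h
  · exact Or.inr h1

theorem not_pref_of_weakPref (E : Economy I O) {i : I} {a b : Option O} (h : E.weakPref i a b) :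
    ¬ E.pref i b a := by
  rcases h with rfl | h
  · exact E.pref_irrefl i a
  · exact E.pref_asymm h

/-! ### Rankings, and why ranked allocations are not blocked -/

/-- `τ` ranks the agents in such a way that the private owner of an assigned object is not ranked
behind its occupant, and envied objects are held by agents who are ranked strictly earlier. -/
structure IsRanking (E : Economy I O) (μ : I → Option O) (τ : I → ℕ) : Prop where
  alloc : IsAllocation μ
  owner_le : ∀ x o p, μ x = some o → E.owners o = {p} → τ p ≤ τ x
  envy_lt : ∀ x y, E.pref x y (μ x) → ∃ o j, y = some o ∧ μ j = some o ∧ τ j < τ x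

theorem subset_iUnion_controlStep (E : Economy I O) (μ : I → Option O) (C : Set I) :
    C ⊆ ⋃ k, E.controlStep μ C k :=
  fun _ hx => Set.mem_iUnion.2 ⟨0, hx⟩

/-- An occupant of a private object whose owner is in the closure of `C` is in that closure. -/
theorem mem_iUnion_controlStep_of_owner (E : Economy I O) {μ : I → Option O} {C : Set I} {x p : I}
    {o : O} (hx : μ x = some o) (ho : E.owners o = {p})
    (hp : p ∈ ⋃ k, E.controlStep μ C k) : x ∈ ⋃ k, E.controlStep μ C k := by
  obtain ⟨k, hk⟩ := Set.mem_iUnion.1 hp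
  refine Set.mem_iUnion.2 ⟨k + 1, Or.inr ⟨o, ?_, hx⟩⟩
  simpa [endow, ho] using hk

/-- Only private objects enlarge the closure: a set endowed with a public object is already
everybody. The index `k'` drops, so that chains of owners can be followed by induction back to `C`.
-/
theorem mem_controlStep_cases (E : Economy I O) (hE : E.PrivatePublic) {μ : I → Option O}
    {C : Set I} {x : I} : ∀ {k : ℕ}, x ∈ E.controlStep μ C k →
      x ∈ C ∨ ∃ o p k', μ x = some o ∧ E.owners o = {p} ∧ k' < k ∧ p ∈ E.controlStep μ C k'
  | 0, h => Or.inl h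
  | k + 1, h => by
    have ih : x ∈ E.controlStep μ C k → x ∈ C ∨ ∃ o p k', μ x = some o ∧ E.owners o = {p} ∧
        k' < k + 1 ∧ p ∈ E.controlStep μ C k' := fun h => by
      rcases mem_controlStep_cases E hE h with h | ⟨o, p, k', h1, h2, h3, h4⟩
      · exact Or.inl h
      · exact Or.inr ⟨o, p, k', h1, h2, h3.trans (Nat.lt_succ_self k), h4⟩
    rcases h with h | ⟨o, ho, hx⟩
    · exact ih h
    · rcases hE o with ⟨p, hp⟩ | hu
      · refine Or.inr ⟨o, p, k, hx, hp, Nat.lt_succ_self k, ho ?_⟩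
        simp [hp]
      · exact ih (ho (by simp [hu]))

theorem mem_iUnion_controlStep_cases (E : Economy I O) (hE : E.PrivatePublic) {μ : I → Option O}
    {C : Set I} {x : I} (hx : x ∈ ⋃ k, E.controlStep μ C k) :
    x ∈ C ∨ ∃ o p, μ x = some o ∧ E.owners o = {p} ∧ p ∈ ⋃ k, E.controlStep μ C k := by
  obtain ⟨k, hk⟩ := Set.mem_iUnion.1 hx
  rcases E.mem_controlStep_cases hE hk with h | ⟨o, p, k', h1, h2, -, h4⟩
  · exact Or.inl h
  · exact Or.inr ⟨o, p, h1, h2, Set.mem_iUnion.2 ⟨k', h4⟩⟩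

/-- Every controlled occupied object is privately owned, unless its occupant is in the
coalition. -/
theorem exists_owner_of_mem_control (E : Economy I O) (hE : E.PrivatePublic) {μ : I → Option O}
    {C : Set I} {x : I} {o : O} (hx : μ x = some o) (ho : o ∈ E.control μ C) (hxC : x ∉ C) :
    ∃ p, E.owners o = {p} ∧ p ∈ ⋃ k, E.controlStep μ C k := by
  rcases hE o with ⟨p, hp⟩ | hu
  · exact ⟨p, hp, ho (by simp [hp])⟩
  -- A controlled public object puts its occupant in the closure. Being outside `C`, she can have
  -- joined only through a private object that she holds, which must be `o`.
  · rcases E.mem_iUnion_controlStep_cases hE (ho (by simp [hu] : x ∈ E.owners o)) with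
      h | ⟨o', p, h1, h2, h3⟩
    · exact absurd h hxC
    · obtain rfl : o = o' := by rw [hx] at h1; exact Option.some.inj h1
      exact ⟨p, h2, h3⟩

/-- Passing from an occupant to the private owner never raises the rank, and the chain of owners
ends in `C`. -/
theorem IsRanking.exists_le_of_mem_controlStep {E : Economy I O} (hE : E.PrivatePublic)
    {μ : I → Option O} {τ : I → ℕ} (h : E.IsRanking μ τ) {C : Set I} :
    ∀ {k : ℕ} {x : I}, x ∈ E.controlStep μ C k → ∃ c ∈ C, τ c ≤ τ x := by
  intro k
  induction k using Nat.strong_induction_on with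
  | _ k ih =>
    intro x hx
    rcases E.mem_controlStep_cases hE hx with hC | ⟨o, p, k', h1, h2, h3, h4⟩
    · exact ⟨x, hC, le_rfl⟩
    · obtain ⟨c, hc, hle⟩ := ih k' h3 h4
      exact ⟨c, hc, hle.trans (h.owner_le x o p h1 h2)⟩

/-- Controlled agents ranked before `n` are controlled by the members ranked before `n`. -/
theorem IsRanking.mem_iUnion_controlStep_of_lt {E : Economy I O} (hE : E.PrivatePublic)
    {μ : I → Option O} {τ : I → ℕ} (h : E.IsRanking μ τ) {C U : Set I} {n : ℕ}
    (hU : ∀ c ∈ C, τ c < n → c ∈ U) :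
    ∀ {k : ℕ} {x : I}, x ∈ E.controlStep μ C k → τ x < n → x ∈ ⋃ k, E.controlStep μ U k := by
  intro k
  induction k using Nat.strong_induction_on with
  | _ k ih =>
    intro x hx hn
    rcases E.mem_controlStep_cases hE hx with hC | ⟨o, p, k', h1, h2, h3, h4⟩
    · exact E.subset_iUnion_controlStep μ U (hU x hC hn)
    · exact E.mem_iUnion_controlStep_of_owner h1 h2
        (ih k' h3 h4 ((h.owner_le x o p h1 h2).trans_lt hn))

theorem exists_first (τ : I → ℕ) {S : Set I} (hS : S.Nonempty) :
    ∃ i ∈ S, ∀ k ∈ S, τ i ≤ τ k := by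
  obtain ⟨i, hi, h⟩ := (measure τ).wf.has_min S hS
  exact ⟨i, hi, fun k hk => not_lt.1 (h k hk)⟩

/-- Members of a self-enforcing coalition (not of everybody) who are ranked before all its
strict improvers form a self-enforcing coalition. -/
theorem IsRanking.selfEnforcing_of_lt {E : Economy I O} (hE : E.PrivatePublic)
    {μ σ : I → Option O} {τ : I → ℕ} (h : E.IsRanking μ τ) {C : Set I} {n : ℕ}
    (hC : C ≠ Set.univ) (hs : E.SelfEnforcing σ C) (hn : ∀ c ∈ C, τ c < n → σ c = μ c) :
    E.SelfEnforcing σ {c ∈ C | τ c < n} := by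
  rintro c ⟨hcC, hcn⟩ o ho
  have hoC := hs c hcC o ho
  rcases hE o with ⟨p, hp⟩ | hu
  · intro q hq
    refine ⟨hoC hq, (h.owner_le c o q ?_ ?_).trans_lt hcn⟩
    · rw [← hn c hcC hcn, ho]
    · rw [hp] at hq ⊢
      rw [Set.mem_singleton_iff.1 hq]
  · exact absurd (Set.univ_subset_iff.1 (hu ▸ hoC)) hC

theorem IsRanking.mem_refinedExclusionCore {E : Economy I O} (hE : E.PrivatePublic)
    {μ : I → Option O} {τ : I → ℕ} (h : E.IsRanking μ τ) : μ ∈ E.refinedExclusionCore := by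
  refine ⟨h.alloc, ?_⟩
  rintro ⟨C, σ, -, hσ, ⟨hw, j₀, hj₀C, hj₀⟩, hh, hab⟩
  -- The minimum runs over all agents, not just `C`: the earlier holder `j` of the object that `i`
  -- gets then cannot improve, so she is harmed and the control clause applies to her.
  obtain ⟨i, hi, hmin⟩ := exists_first τ (S := {i | E.pref i (σ i) (μ i)}) ⟨j₀, hj₀⟩
  obtain ⟨o, j, hio, hjo, hlt⟩ := h.envy_lt i _ hi
  have hne : μ j ≠ σ j := fun he => by
    have := hσ i j o hio (he ▸ hjo)
    subst this
    exact lt_irrefl _ hlt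
  have hharm : E.pref j (μ j) (σ j) :=
    (E.pref_total j hne).resolve_right fun h' => absurd (hmin j h') (not_le.2 hlt)
  have hjC : j ∉ C := fun hj => E.not_pref_of_weakPref (hw j hj) hharm
  obtain ⟨o', ho', hjo'⟩ := hh j hharm
  obtain rfl : o = o' := by rw [hjo] at hjo'; exact Option.some.inj hjo'
  obtain ⟨p, hp, hpD⟩ := E.exists_owner_of_mem_control hE hjo ho' hjC
  have hpi : τ p < τ i := (h.owner_le j o p hjo hp).trans_lt hlt
  have hsame : ∀ c ∈ C, τ c < τ i → σ c = μ c := fun c hc hci =>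
    (hw c hc).resolve_right fun h' => absurd (hmin c h') (not_le.2 hci)
  obtain ⟨k, hk⟩ := Set.mem_iUnion.1 hpD
  have hpU : p ∈ ⋃ k, E.controlStep μ (unaffected C σ μ) k :=
    h.mem_iUnion_controlStep_of_lt hE (U := unaffected C σ μ)
      (fun c hc hci => ⟨hc, hsame c hc hci⟩) hk hpi
  obtain ⟨k', hk'⟩ := Set.mem_iUnion.1 hpU
  obtain ⟨c, hcU, hcp⟩ := h.exists_le_of_mem_controlStep hE hk'
  -- In case (a) the harmed `j` held an object controlled by unaffected members. In case (b) the
  -- members before `i` are a smaller self-enforcing coalition, proper because it misses the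
  -- improver `j₀`.
  rcases hab ⟨c, hcU⟩ with ⟨-, ha⟩ | ⟨hse, hb⟩
  · refine ha j hharm ⟨o, ?_, hjo⟩
    intro q hq
    rw [hp] at hq
    rwa [Set.mem_singleton_iff.1 hq]
  · refine hb {c ∈ C | τ c < τ i} ⟨c, hcU.1, hcp.trans_lt hpi⟩ ⟨fun x hx => hx.1, ?_⟩
      (h.selfEnforcing_of_lt hE (fun he => hjC (he ▸ Set.mem_univ j)) hse hsame)
    exact fun hsub => absurd (hmin j₀ hj₀) (not_le.2 (hsub hj₀C).2)

/-- The first improver in `C` takes an object from an outsider `j`, so `C` is not everybody and the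
object is private. The members ranked before the improver serve as the forbidden `C'`: they are
unaffected, self-enforcing and include the owner of that object. -/
theorem IsRanking.mem_rectifiedCore {E : Economy I O} (hE : E.PrivatePublic)
    {μ : I → Option O} {τ : I → ℕ} (h : E.IsRanking μ τ) : μ ∈ E.rectifiedCore := by
  refine ⟨h.alloc, ?_⟩
  rintro ⟨C, σ, -, hσ, ⟨hw, j₀, hj₀C, hj₀⟩, hse, hr⟩
  obtain ⟨i, ⟨hiC, hi⟩, hmin⟩ :=
    exists_first τ (S := {i | i ∈ C ∧ E.pref i (σ i) (μ i)}) ⟨j₀, hj₀C, hj₀⟩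
  obtain ⟨o, j, hio, hjo, hlt⟩ := h.envy_lt i _ hi
  have hsame : ∀ c ∈ C, τ c < τ i → σ c = μ c := fun c hc hci =>
    (hw c hc).resolve_right fun h' => absurd (hmin c ⟨hc, h'⟩) (not_le.2 hci)
  have hjC : j ∉ C := fun hj => by
    have := hσ i j o hio ((hsame j hj hlt).trans hjo)
    subst this
    exact lt_irrefl _ hlt
  have hCne : C ≠ Set.univ := fun he => hjC (he ▸ Set.mem_univ j)
  have hoC := hse i hiC o hio
  rcases hE o with ⟨p, hp⟩ | hu
  · have hpC : p ∈ C := hoC (by simp [hp])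
    have hpi : τ p < τ i := (h.owner_le j o p hjo hp).trans_lt hlt
    refine hr {c ∈ C | τ c < τ i} ⟨p, hpC, hpi⟩ (fun c hc => ⟨hc.1, hsame c hc.1 hc.2⟩)
      (h.selfEnforcing_of_lt hE hCne hse hsame) i ⟨hiC, fun h' => lt_irrefl _ h'.2⟩ o hio ?_
      ⟨j, hjC, hjo⟩
    intro q hq
    rw [hp] at hq
    rw [Set.mem_singleton_iff.1 hq]
    exact ⟨hpC, hpi⟩
  · exact hCne (Set.univ_subset_iff.1 (hu ▸ hoC))

/-- In an exclusion block every member improves, so nobody is unaffected and the extra clause of a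
refined block is void. -/
theorem refinedExclusionCore_subset_exclusionCore (E : Economy I O) :
    E.refinedExclusionCore ⊆ E.exclusionCore := by
  rintro μ ⟨hμ, h⟩
  refine ⟨hμ, ?_⟩
  rintro ⟨C, σ, ⟨c, hc⟩, hσ, h1, h2⟩
  refine h ⟨C, σ, ⟨c, hc⟩, hσ, ⟨fun i hi => Or.inr (h1 i hi), c, hc, h1 c hc⟩, h2, ?_⟩
  rintro ⟨i, hi, he⟩
  exact absurd (he ▸ h1 i hi) (E.pref_irrefl i _)

/-! ### Every run of the algorithm yields a ranking -/

theorem highest_mem {r : List I} {X : Set I} {k : I} (h : highest r X = some k) : k ∈ X := by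
  have := List.find?_some h
  simpa using this

/-- All arcs of the state are between remaining agents and remaining objects, except that
removed objects may still point to remaining agents. -/
structure Fresh (s : YState I O) : Prop where
  agent : ∀ j o, s.agentArc j = some o → j ∈ s.order ∧ o ∈ s.objs
  obj : ∀ o k, s.objArc o = some k → k ∈ s.order

theorem fresh_refresh (E : Economy I O) (r : List I) (s : YState I O) :
    Fresh (E.refresh r s) := by
  constructor
  · intro j o h
    simp only [refresh] at h ⊢
    split_ifs at h with hc
    obtain ⟨hj, o', ho', he⟩ := hc
    rw [he] at h
    cases h
    exact ⟨hj, ho'⟩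
  · intro o k h
    simp only [refresh] at h ⊢
    split_ifs at h with h1 h2
    · exact (highest_mem h).1
    · exact (highest_mem h).1
    · by_contra hk
      exact h1 ⟨k, h, hk⟩

/-- Refreshing is idempotent, and it does nothing between the requests of one cycle, when nobody
leaves. -/
theorem Fresh.refresh_eq {s : YState I O} (h : Fresh s) (E : Economy I O) (r : List I) :
    E.refresh r s = s := by
  have h1 : ∀ j, (E.refresh r s).agentArc j = s.agentArc j := by
    intro j
    simp only [refresh]
    split_ifs with hc
    · rfl
    · rcases hj : s.agentArc j with _ | o
      · rfl
      · exact absurd ⟨(h.agent j o hj).1, o, (h.agent j o hj).2, hj⟩ hc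
  have h2 : ∀ o, (E.refresh r s).objArc o = s.objArc o := by
    intro o
    simp only [refresh]
    rw [if_neg]
    rintro ⟨k, hk, hk'⟩
    exact hk' (h.obj o k hk)
  have h1' := funext h1
  have h2' := funext h2
  cases s
  simp only [refresh] at h1' h2' ⊢
  rw [h1', h2']

theorem IsFavorite.mono {E : Economy I O} {i : I} {A B : Set O} {x : Option O}
    (h : E.IsFavorite i A x) (hBA : B ⊆ A) (hx : ∀ o, x = some o → o ∈ B) :
    E.IsFavorite i B x :=
  ⟨hx, fun y hy => h.2 y fun o ho => hBA (hy o ho)⟩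

/-- What is known about a state of the algorithm if `τ x` is the time at which the agent `x` was
removed, all these times being less than `N`. -/
structure RunInv (E : Economy I O) (s : YState I O) (τ : I → ℕ) (N : ℕ) : Prop where
  lt : ∀ x, x ∉ s.order → τ x < N
  objs : ∀ o, o ∈ s.objs ↔ ∀ j, j ∉ s.order → s.result j ≠ some o
  alloc : ∀ i j o, i ∉ s.order → j ∉ s.order → s.result i = some o → s.result j = some o → i = j
  owner : ∀ x o p, x ∉ s.order → s.result x = some o → E.owners o = {p} →
    p ∉ s.order ∧ τ p ≤ τ x
  envy : ∀ x y, x ∉ s.order → E.pref x y (s.result x) →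
    ∃ o j, y = some o ∧ j ∉ s.order ∧ s.result j = some o ∧ τ j < τ x
  arc : ∀ o p, o ∈ s.objs → E.owners o = {p} → p ∈ s.order → s.objArc o = some p
  fav : ∀ j o, j ∈ s.order → o ∈ s.objs → s.agentArc j = some o →
    E.IsFavorite j s.objs (some o)

theorem RunInv.refresh {E : Economy I O} {s : YState I O} {τ : I → ℕ} {N : ℕ}
    (h : E.RunInv s τ N) (r : List I) : E.RunInv (E.refresh r s) τ N where
  lt := h.lt
  objs := h.objs
  alloc := h.alloc
  owner := h.owner
  envy := h.envy
  arc := by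
    intro o p ho hp hpo
    have := h.arc o p ho hp hpo
    simp only [Economy.refresh]
    rw [if_neg, this]
    rintro ⟨k, hk, hk'⟩
    rw [this] at hk
    cases hk
    exact hk' hpo
  fav := by
    intro j o hj ho hjo
    simp only [Economy.refresh] at hjo
    split_ifs at hjo
    exact h.fav j o hj ho hjo

open Classical in
/-- The invariant survives the removal of a set of agents with their favorite objects. -/
theorem RunInv.remove {E : Economy I O} {s s' : YState I O} {τ : I → ℕ} {N : ℕ}
    (h : E.RunInv s τ N) {Z : Set I} {ν : I → Option O} (hZ : ∀ z ∈ Z, z ∈ s.order)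
    (hfav : ∀ z ∈ Z, E.IsFavorite z s.objs (ν z))
    (hinj : ∀ z ∈ Z, ∀ w ∈ Z, ∀ o, ν z = some o → ν w = some o → z = w)
    (hown : ∀ z ∈ Z, ∀ o p, ν z = some o → E.owners o = {p} → p ∈ s.order → p ∈ Z)
    (horder : ∀ j, j ∈ s'.order ↔ j ∈ s.order ∧ j ∉ Z)
    (hobjs : ∀ o, o ∈ s'.objs ↔ o ∈ s.objs ∧ ∀ z ∈ Z, ν z ≠ some o)
    (hres : ∀ z ∈ Z, s'.result z = ν z) (hres' : ∀ z, z ∉ Z → s'.result z = s.result z)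
    (hA : s'.agentArc = s.agentArc) (hO : s'.objArc = s.objArc) :
    E.RunInv s' (fun x => if x ∈ Z then N else τ x) (N + 1) := by
  have hout : ∀ x, x ∉ s'.order ↔ x ∈ Z ∨ (x ∉ Z ∧ x ∉ s.order) := by
    intro x
    rw [horder]
    tauto
  have hmem : ∀ z ∈ Z, ∀ o, ν z = some o → o ∈ s.objs := fun z hz o ho => (hfav z hz).1 o ho
  have hsub : s'.objs ⊆ s.objs := fun o ho => ((hobjs o).1 ho).1
  refine ⟨?_, ?_, ?_, ?_, ?_, ?_, ?_⟩
  · intro x hx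
    rcases (hout x).1 hx with hz | ⟨hz, hx⟩
    · simp [hz]
    · simpa [hz] using (h.lt x hx).trans (Nat.lt_succ_self N)
  · intro o
    rw [hobjs, h.objs]
    constructor
    · rintro ⟨h1, h2⟩ j hj
      rcases (hout j).1 hj with hz | ⟨hz, hx⟩
      · rw [hres j hz]; exact h2 j hz
      · rw [hres' j hz]; exact h1 j hx
    · intro h1
      refine ⟨fun j hj => ?_, fun z hz => ?_⟩
      · have hz : j ∉ Z := fun hz => hj (hZ j hz)
        rw [← hres' j hz]
        exact h1 j ((hout j).2 (Or.inr ⟨hz, hj⟩))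
      · rw [← hres z hz]
        exact h1 z ((hout z).2 (Or.inl hz))
  · intro i j o hi hj hio hjo
    rcases (hout i).1 hi with hiz | ⟨hiz, hi⟩ <;> rcases (hout j).1 hj with hjz | ⟨hjz, hj⟩
    · rw [hres i hiz] at hio
      rw [hres j hjz] at hjo
      exact hinj i hiz j hjz o hio hjo
    · rw [hres i hiz] at hio
      rw [hres' j hjz] at hjo
      exact absurd hjo ((h.objs o).1 (hmem i hiz o hio) j hj)
    · rw [hres' i hiz] at hio
      rw [hres j hjz] at hjo
      exact absurd hio ((h.objs o).1 (hmem j hjz o hjo) i hi)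
    · rw [hres' i hiz] at hio
      rw [hres' j hjz] at hjo
      exact h.alloc i j o hi hj hio hjo
  · intro x o p hx hxo hp
    rcases (hout x).1 hx with hz | ⟨hz, hx⟩
    · rw [hres x hz] at hxo
      by_cases hpo : p ∈ s.order
      · have hpZ := hown x hz o p hxo hp hpo
        exact ⟨(hout p).2 (Or.inl hpZ), by simp [hpZ, hz]⟩
      · have hpZ : p ∉ Z := fun h' => hpo (hZ p h')
        exact ⟨(hout p).2 (Or.inr ⟨hpZ, hpo⟩), by simpa [hpZ, hz] using (h.lt p hpo).le⟩
    · rw [hres' x hz] at hxo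
      obtain ⟨hpo, hle⟩ := h.owner x o p hx hxo hp
      have hpZ : p ∉ Z := fun h' => hpo (hZ p h')
      exact ⟨(hout p).2 (Or.inr ⟨hpZ, hpo⟩), by simpa [hpZ, hz] using hle⟩
  · intro x y hx hxy
    rcases (hout x).1 hx with hz | ⟨hz, hx⟩
    · rw [hres x hz] at hxy
      -- Since `x` obtains her favorite remaining object, what she envies must be gone already, so
      -- its holder has a time below `N`.
      have hy : ¬ ∀ o, y = some o → o ∈ s.objs := by
        intro hy
        by_cases hne : y = ν x
        · rw [hne] at hxy
          exact E.pref_irrefl x _ hxy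
        · exact E.pref_asymm hxy ((hfav x hz).2 y hy hne)
      push Not at hy
      obtain ⟨o, rfl, ho⟩ := hy
      rw [h.objs] at ho
      push Not at ho
      obtain ⟨j, hj, hjo⟩ := ho
      have hjZ : j ∉ Z := fun h' => hj (hZ j h')
      exact ⟨o, j, rfl, (hout j).2 (Or.inr ⟨hjZ, hj⟩), by rw [hres' j hjZ, hjo],
        by simpa [hz, hjZ] using h.lt j hj⟩
    · rw [hres' x hz] at hxy
      obtain ⟨o, j, rfl, hj, hjo, hlt⟩ := h.envy x y hx hxy
      have hjZ : j ∉ Z := fun h' => hj (hZ j h')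
      exact ⟨o, j, rfl, (hout j).2 (Or.inr ⟨hjZ, hj⟩), by rw [hres' j hjZ, hjo],
        by simpa [hz, hjZ] using hlt⟩
  · intro o p ho hp hpo
    rw [hO]
    exact h.arc o p (hsub ho) hp ((horder p).1 hpo).1
  · intro j o hj ho hjo
    rw [hA] at hjo
    refine (h.fav j o ((horder j).1 hj).1 (hsub ho) hjo).mono hsub ?_
    rintro _ ⟨⟩
    exact ho

theorem link_unique {s : YState I O} {j k k' : I} (h : link s j k) (h' : link s j k') :
    k = k' := by
  obtain ⟨o, h1, h2⟩ := h
  obtain ⟨o', h1', h2'⟩ := h'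
  rw [h1] at h1'
  cases h1'
  rw [h2] at h2'
  exact Option.some.inj h2'

theorem reflTransGen_of_link {s : YState I O} {j k i : I} (h : link s j k)
    (hi : Relation.TransGen (link s) j i) : Relation.ReflTransGen (link s) k i := by
  rcases Relation.TransGen.head'_iff.1 hi with ⟨k', hk', hr⟩
  rwa [link_unique h hk']

/-- The cycle is closed under the successor relation. -/
theorem mem_cycleAgents_of_link {s : YState I O} {i j k : I} (hj : j ∈ cycleAgents s i)
    (h : link s j k) : k ∈ cycleAgents s i := by
  refine ⟨hj.1.tail h, ?_⟩
  rcases Relation.reflTransGen_iff_eq_or_transGen.1 (reflTransGen_of_link h hj.2) with he | ht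
  · subst he
    exact hj.1.tail h
  · exact ht

-- Arcs have unique targets, so `link` is the graph of a partial function. It is made total by
-- fixing agents without a link, which lets cycles be treated as periodic orbits.
open Classical in
theorem exists_iterate_of_transGen {s : YState I O} {i j : I}
    (h : Relation.TransGen (link s) i j) :
    ∃ n, (fun x => if hx : ∃ k, link s x k then hx.choose else x)^[n + 1] i = j := by
  set f : I → I := fun x => if hx : ∃ k, link s x k then hx.choose else x with hf
  have hl : ∀ x k, link s x k → f x = k := by
    intro x k hx
    have hex : ∃ k, link s x k := ⟨k, hx⟩
    simp only [hf, dif_pos hex]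
    exact link_unique hex.choose_spec hx
  induction h with
  | single h => exact ⟨0, hl _ _ h⟩
  | tail _ h ih =>
    obtain ⟨n, hn⟩ := ih
    exact ⟨n + 1, by rw [Function.iterate_succ_apply', hn, hl _ _ h]⟩

/-- Two agents of the cycle do not point to the same object. -/
theorem eq_of_link_of_mem_cycleAgents {s : YState I O} {i j j' k : I}
    (hj : j ∈ cycleAgents s i) (hj' : j' ∈ cycleAgents s i) (h : link s j k)
    (h' : link s j' k) : j = j' := by
  classical
  obtain ⟨m, hm⟩ := exists_iterate_of_transGen (hj.2.trans hj.1)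
  obtain ⟨n, hn⟩ := exists_iterate_of_transGen (hj'.2.trans hj'.1)
  refine Function.IsPeriodicPt.eq_of_apply_eq hm hn m.succ_pos n.succ_pos ?_
  have hl : ∀ x, link s x k →
      (fun x => if hx : ∃ k, link s x k then hx.choose else x) x = k := by
    intro x hx
    have hex : ∃ k, link s x k := ⟨k, hx⟩
    simp only [dif_pos hex]
    exact link_unique hex.choose_spec hx
  exact (hl j h).trans (hl j' h').symm

theorem exists_link_of_mem_cycleAgents {s : YState I O} {i j : I} (hj : j ∈ cycleAgents s i) :
    ∃ k, link s j k := by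
  rcases Relation.TransGen.head'_iff.1 hj.2 with ⟨k, hk, -⟩
  exact ⟨k, hk⟩

theorem pointTo_agentArc_self (s : YState I O) (i : I) (o : O) :
    (pointTo s i o).agentArc i = some o := by
  simp [pointTo]

theorem pointTo_agentArc_of_ne {s : YState I O} {i j : I} {o : O} (h : j ≠ i) :
    (pointTo s i o).agentArc j = s.agentArc j := by
  simp [pointTo, h]

theorem RunInv.pointTo {E : Economy I O} {s : YState I O} {τ : I → ℕ} {N : ℕ}
    (h : E.RunInv s τ N) {i : I} {o : O} (hx : E.IsFavorite i s.objs (some o)) :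
    E.RunInv (pointTo s i o) τ N where
  lt := h.lt
  objs := h.objs
  alloc := h.alloc
  owner := h.owner
  envy := h.envy
  arc := h.arc
  fav := by
    intro j o' hj ho hjo
    by_cases he : j = i
    · subst he
      rw [pointTo_agentArc_self] at hjo
      cases hjo
      exact hx
    · rw [pointTo_agentArc_of_ne he] at hjo
      exact h.fav j o' hj ho hjo

theorem fresh_pointTo {s : YState I O} (h : Fresh s) {i : I} {o : O} (hi : i ∈ s.order)
    (ho : o ∈ s.objs) : Fresh (pointTo s i o) where
  agent := by
    intro j o' hjo
    by_cases he : j = i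
    · subst he
      rw [pointTo_agentArc_self] at hjo
      cases hjo
      exact ⟨hi, ho⟩
    · rw [pointTo_agentArc_of_ne he] at hjo
      exact h.agent j o' hjo
  obj := h.obj

theorem mem_moveTop {s : YState I O} {k : I} (hk : k ∈ s.order) (j : I) :
    j ∈ (moveTop s k).order ↔ j ∈ s.order := by
  by_cases he : j = k
  · subst he
    simp [moveTop, hk]
  · simp [moveTop, he]

theorem fresh_moveTop {s : YState I O} (h : Fresh s) {k : I} (hk : k ∈ s.order) :
    Fresh (moveTop s k) where
  agent := fun j o hjo => ⟨(mem_moveTop hk j).2 (h.agent j o hjo).1, (h.agent j o hjo).2⟩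
  obj := fun o j hj => (mem_moveTop hk j).2 (h.obj o j hj)

theorem RunInv.moveTop {E : Economy I O} {s : YState I O} {τ : I → ℕ} {N : ℕ}
    (h : E.RunInv s τ N) {k : I} (hk : k ∈ s.order) : E.RunInv (moveTop s k) τ N where
  lt := fun x hx => h.lt x (by rwa [mem_moveTop hk] at hx)
  objs := fun o => by
    simp only [mem_moveTop hk]
    exact h.objs o
  alloc := fun i j o hi hj => h.alloc i j o (by rwa [mem_moveTop hk] at hi)
    (by rwa [mem_moveTop hk] at hj)
  owner := fun x o p hx => by
    simp only [mem_moveTop hk] at hx ⊢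
    exact h.owner x o p hx
  envy := fun x y hx => by
    simp only [mem_moveTop hk] at hx ⊢
    exact h.envy x y hx
  arc := fun o p ho hp hpo => h.arc o p ho hp ((mem_moveTop hk p).1 hpo)
  fav := fun j o hj => h.fav j o ((mem_moveTop hk j).1 hj)

theorem RunInv.removeSingle {E : Economy I O} {s : YState I O} {τ : I → ℕ} {N : ℕ}
    (h : E.RunInv s τ N) {i : I} {x : Option O} (hi : i ∈ s.order)
    (hx : E.IsFavorite i s.objs x) (hown : ∀ o, x = some o → s.objArc o = none) :
    ∃ τ' N', E.RunInv (removeSingle s i x) τ' N' := by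
  classical
  refine ⟨_, _, h.remove (Z := {i}) (ν := fun _ => x) ?_ ?_ ?_ ?_ ?_ ?_ ?_ ?_ rfl rfl⟩
  · rintro _ rfl; exact hi
  · rintro _ rfl; exact hx
  · rintro _ rfl _ rfl _ _ _; rfl
  · rintro _ rfl o p ho hp hpo
    have := h.arc o p (hx.1 o ho) hp hpo
    rw [hown o ho] at this
    cases this
  · intro j; simp [Economy.removeSingle]
  · intro o; simp [Economy.removeSingle]
  · rintro _ rfl; simp [Economy.removeSingle]
  · intro z hz
    exact Function.update_of_ne hz _ _

/-- Pending requests still point to favorites because the set of objects only shrinks. A remaining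
private owner of a cycle object is its target, hence on the cycle. -/
theorem RunInv.removeCycle {E : Economy I O} {s : YState I O} {τ : I → ℕ} {N : ℕ}
    (h : E.RunInv s τ N) (hf : Fresh s) (i : I) :
    ∃ τ' N', E.RunInv (E.removeCycle s i) τ' N' := by
  classical
  refine ⟨_, _, h.remove (Z := cycleAgents s i) (ν := s.agentArc) ?_ ?_ ?_ ?_ ?_ ?_ ?_ ?_
    rfl rfl⟩
  · intro z hz
    obtain ⟨k, o, ho, -⟩ := exists_link_of_mem_cycleAgents hz
    exact (hf.agent z o ho).1
  · intro z hz
    obtain ⟨k, o, ho, -⟩ := exists_link_of_mem_cycleAgents hz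
    rw [ho]
    exact h.fav z o (hf.agent z o ho).1 (hf.agent z o ho).2 ho
  · intro z hz w hw o hzo hwo
    obtain ⟨k, o', ho', hk⟩ := exists_link_of_mem_cycleAgents hz
    rw [hzo] at ho'
    cases ho'
    exact eq_of_link_of_mem_cycleAgents hz hw ⟨o, hzo, hk⟩ ⟨o, hwo, hk⟩
  · intro z hz o p hzo hp hpo
    exact mem_cycleAgents_of_link hz ⟨o, hzo, h.arc o p (hf.agent z o hzo).2 hp hpo⟩
  · intro j; simp [Economy.removeCycle]
  · intro o
    simp only [Economy.removeCycle, cycleObjs, Set.mem_sdiff, Set.mem_ofPred_eq, not_exists,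
      not_and]
  · intro z hz; simp [Economy.removeCycle, hz]
  · intro z hz; simp [Economy.removeCycle, hz]

theorem RunInv.step {E : Economy I O} {r : List I} {s s' : YState I O} {τ : I → ℕ} {N : ℕ}
    (h : E.RunInv s τ N) (hs : E.YStep r s s') : ∃ τ' N', E.RunInv s' τ' N' := by
  have h' := h.refresh r
  have hf := E.fresh_refresh r s
  unfold YStep at hs
  generalize E.refresh r s = t at hs h' hf
  cases hs with
  | null i hi hx =>
    exact h'.removeSingle (List.mem_of_mem_head? hi) hx (by simp)
  | direct i o hi hx ho =>
    refine h'.removeSingle (List.mem_of_mem_head? hi) hx ?_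
    rintro _ ⟨⟩
    exact ho
  | cycle i o hi hx ho hc =>
    exact (h'.pointTo hx).removeCycle
      (fresh_pointTo hf (List.mem_of_mem_head? hi) (hx.1 o rfl)) i
  | move i o k hi hx ho hc =>
    exact ⟨τ, N, (h'.pointTo hx).moveTop (hf.obj o k ho)⟩

theorem highest_singleton {r : List I} {p : I} (hp : p ∈ r) : highest r {p} = some p := by
  rcases hh : highest r {p} with _ | k
  · have := List.find?_eq_none.1 hh p hp
    simp at this
  · rw [Set.mem_singleton_iff.1 (highest_mem hh)]

theorem runInv_init (E : Economy I O) {r : List I} (hr : ∀ i, i ∈ r) :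
    E.RunInv (E.yInit r) (fun _ => 0) 0 where
  lt := fun x hx => absurd (hr x) hx
  objs := fun o => ⟨fun _ j hj => absurd (hr j) hj, fun _ => Set.mem_univ o⟩
  alloc := fun i _ _ hi => absurd (hr i) hi
  owner := fun x _ _ hx => absurd (hr x) hx
  envy := fun x _ hx => absurd (hr x) hx
  arc := fun o p _ hp hpo => by
    simp only [yInit, hp]
    exact highest_singleton hpo
  fav := fun j o _ _ h => by simp [yInit] at h

theorem exists_isRanking_of_mem_yrmhOutcomes {E : Economy I O} {μ : I → Option O}
    (h : μ ∈ E.yrmhOutcomes) : ∃ τ, E.IsRanking μ τ := by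
  obtain ⟨r, -, hr, s, hs, hend, rfl⟩ := h
  have key : ∃ τ N, E.RunInv s τ N := by
    clear hend
    induction hs with
    | refl => exact ⟨_, _, E.runInv_init hr⟩
    | tail _ hstep ih =>
      obtain ⟨τ, N, hinv⟩ := ih
      exact hinv.step hstep
  obtain ⟨τ, N, hinv⟩ := key
  have hout : ∀ x, x ∉ s.order := by simp [hend]
  refine ⟨τ, fun i j o => hinv.alloc i j o (hout i) (hout j),
    fun x o p hx hp => (hinv.owner x o p (hout x) hx hp).2, fun x y hxy => ?_⟩
  obtain ⟨o, j, h1, -, h2, h3⟩ := hinv.envy x y (hout x) hxy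
  exact ⟨o, j, h1, h2, h3⟩

/-! ### Decomposing an allocation of the exclusion core -/

theorem exists_iterate_eq_of_mem_periodicPts {α : Type*} {f : α → α} {x : α}
    (hx : x ∈ Function.periodicPts f) (n : ℕ) : ∃ k, f^[k] (f^[n] x) = x := by
  obtain ⟨m, hm, hp⟩ := hx
  refine ⟨m * n - n, ?_⟩
  rw [← Function.iterate_add_apply, Nat.sub_add_cancel (Nat.le_mul_of_pos_left n hm)]
  exact hp.mul_const n

theorem exists_mem_periodicPts_iterate {α : Type*} [Finite α] (f : α → α) (x : α) :
    ∃ n, f^[n] x ∈ Function.periodicPts f := by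
  obtain ⟨a, b, hab, he⟩ := Finite.exists_ne_map_eq_of_infinite fun n : ℕ => f^[n] x
  wlog hlt : a < b generalizing a b
  · exact this b a hab.symm he.symm (lt_of_le_of_ne (not_lt.1 hlt) hab.symm)
  refine ⟨a, b - a, Nat.sub_pos_of_lt hlt, ?_⟩
  rw [Function.IsPeriodicPt, Function.IsFixedPt, ← Function.iterate_add_apply,
    Nat.sub_add_cancel hlt.le]
  exact he.symm

theorem exists_isFavorite [Finite O] (E : Economy I O) (i : I) (A : Set O) :
    ∃ x, E.IsFavorite i A x := by
  have := E.pref_strictTotal i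
  have hwf : WellFounded (E.pref i) := Finite.wellFounded_of_trans_of_irrefl _
  obtain ⟨x, hx, hmin⟩ := hwf.has_min {x : Option O | ∀ o, x = some o → o ∈ A} ⟨none, by simp⟩
  exact ⟨x, hx, fun y hy hne => (E.pref_total i hne).resolve_left (hmin y hy)⟩

/-- The objects that remain if all agents outside `J` have left with their assignments. -/
def avail (μ : I → Option O) (J : Set I) : Set O :=
  {o | ∀ j, μ j = some o → j ∈ J}

/-- In an allocation that is not exclusion-blocked, some remaining agent holds her favorite
remaining object and that object has no other remaining private owner, or there is a trading cycle
of private owners who hold their favorite remaining objects. -/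
theorem exists_single_or_cycle [Finite I] [Finite O] {E : Economy I O}
    {μ : I → Option O} (hμ : μ ∈ E.exclusionCore) {J : Set I} (hJ : J.Nonempty) :
    (∃ i ∈ J, E.IsFavorite i (avail μ J) (μ i) ∧
      ∀ o p, μ i = some o → E.owners o = {p} → p ∈ J → p = i) ∨
    ∃ (f : I → I) (x : I), x ∈ Function.periodicPts f ∧ ∀ n, f^[n] x ∈ J ∧
      ∃ o, μ (f^[n] x) = some o ∧ E.owners o = {f (f^[n] x)} ∧
        E.IsFavorite (f^[n] x) (avail μ J) (some o) := by
  classical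
  rw [or_iff_not_imp_left]
  intro hns
  push Not at hns
  choose fav hfav using fun i => E.exists_isFavorite i (avail μ J)
  -- Agent `i` looks at the remaining private owner of her favorite; failing that, at its holder in
  -- `μ`; and at herself if nobody holds it or it is null.
  have hsucc : ∀ i, ∃ k, i ∈ J → k ∈ J ∧ (fav i = none → k = i) ∧ ∀ o, fav i = some o →
      (∀ p ∈ J, E.owners o = {p} → k = p) ∧ ((∀ p ∈ J, E.owners o ≠ {p}) →
        (∀ w, μ w = some o → k = w) ∧ ((∀ w, μ w ≠ some o) → k = i)) := by
    intro i
    rcases hi : fav i with _ | o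
    · exact ⟨i, fun h => ⟨h, by simp, by simp⟩⟩
    · have ho : o ∈ avail μ J := (hfav i).1 o hi
      by_cases hp : ∃ p ∈ J, E.owners o = {p}
      · obtain ⟨p, hpJ, hp⟩ := hp
        refine ⟨p, fun h => ⟨hpJ, by simp, ?_⟩⟩
        rintro _ ⟨⟩
        refine ⟨fun q _ hq => ?_, fun h' => absurd hp (h' p hpJ)⟩
        rw [hp] at hq
        exact Set.singleton_injective hq
      · push Not at hp
        by_cases hw : ∃ w, μ w = some o
        · obtain ⟨w, hw⟩ := hw
          refine ⟨w, fun h => ⟨ho w hw, by simp, ?_⟩⟩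
          rintro _ ⟨⟩
          exact ⟨fun q hq hqo => absurd hqo (hp q hq),
            fun _ => ⟨fun w' hw' => hμ.1 w w' o hw hw', fun h' => absurd hw (h' w)⟩⟩
        · push Not at hw
          refine ⟨i, fun h => ⟨h, by simp, ?_⟩⟩
          rintro _ ⟨⟩
          exact ⟨fun q hq hqo => absurd hqo (hp q hq),
            fun _ => ⟨fun w' hw' => absurd hw' (hw w'), fun _ => rfl⟩⟩
  choose f hf using hsucc
  obtain ⟨x₀, hx₀⟩ := hJ
  have hitJ : ∀ n, ∀ z ∈ J, f^[n] z ∈ J := by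
    intro n
    induction n with
    | zero => exact fun z hz => hz
    | succ n ih => exact fun z hz => ih (f z) (hf z hz).1
  obtain ⟨a, ha⟩ := exists_mem_periodicPts_iterate f x₀
  set y := f^[a] x₀ with hy
  have hyJ : y ∈ J := hitJ a x₀ hx₀
  set Z : Set I := Set.range fun n => f^[n] y with hZ
  have hZJ : ∀ z ∈ Z, z ∈ J := by
    rintro _ ⟨n, rfl⟩
    exact hitJ n y hyJ
  have hZf : ∀ z ∈ Z, f z ∈ Z := by
    rintro _ ⟨n, rfl⟩
    exact ⟨n + 1, Function.iterate_succ_apply' f n y⟩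
  have hZtrans : ∀ z ∈ Z, ∀ w ∈ Z, ∃ n, f^[n] z = w := by
    rintro _ ⟨m, rfl⟩ _ ⟨n, rfl⟩
    obtain ⟨k, hk⟩ := exists_iterate_eq_of_mem_periodicPts ha m
    exact ⟨n + k, by rw [Function.iterate_add_apply]; simp only [hk]⟩
  have hZfix : ∀ z ∈ Z, f z = z → ∀ w ∈ Z, w = z := by
    intro z hz hfz w hw
    obtain ⟨n, hn⟩ := hZtrans z hz w hw
    rw [← hn, Function.iterate_fixed hfz]
  have hZinj : ∀ z ∈ Z, ∀ w ∈ Z, f z = f w → z = w := by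
    obtain ⟨m, hm, hp⟩ := ha
    rintro _ ⟨k, rfl⟩ _ ⟨n, rfl⟩ he
    exact (hp.apply_iterate k).eq_of_apply_eq (hp.apply_iterate n) hm hm he
  have hμfav : ∀ z ∈ J, μ z ≠ fav z → E.pref z (fav z) (μ z) := fun z hz hne =>
    (hfav z).2 (μ z) (fun o ho j hj => by rwa [hμ.1 j z o hj ho]) hne
  by_cases hall : ∀ z ∈ Z, μ z = fav z
  · refine ⟨f, y, ha, fun n => ?_⟩
    have hz : f^[n] y ∈ Z := ⟨n, rfl⟩
    generalize f^[n] y = z at hz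
    have hzJ := hZJ z hz
    refine ⟨hzJ, ?_⟩
    obtain ⟨o, p, ho, hp, hpJ, -⟩ := hns z hzJ (by rw [hall z hz]; exact hfav z)
    have hfo : fav z = some o := by rw [← hall z hz, ho]
    refine ⟨o, ho, ?_, hfo ▸ hfav z⟩
    rw [(((hf z hzJ).2.2 o hfo).1 p hpJ hp), hp]
  · exfalso
    push Not at hall
    obtain ⟨c₀, hc₀Z, hc₀⟩ := hall
    -- The would-be blocking coalition: agents of the orbit who do not hold their favorites.
    set C : Set I := {z | z ∈ Z ∧ μ z ≠ fav z} with hC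
    -- Control spreads backwards along the orbit: an agent holding her favorite occupies an object
    -- of her successor, or is her own successor. Hence `C` controls all of `Z`.
    have hstep : ∀ z ∈ Z, μ z = fav z →
        f z ∈ ⋃ k, E.controlStep μ C k → z ∈ ⋃ k, E.controlStep μ C k := by
      intro z hz hzs hD
      have hzJ := hZJ z hz
      rcases hzf : fav z with _ | o
      · rwa [(hf z hzJ).2.1 hzf] at hD
      · have hzo := (hf z hzJ).2.2 o hzf
        by_cases hp : ∃ p ∈ J, E.owners o = {p}
        · obtain ⟨p, hpJ, hp⟩ := hp
          rw [hzo.1 p hpJ hp] at hD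
          exact E.mem_iUnion_controlStep_of_owner (hzs.trans hzf) hp hD
        · push Not at hp
          rwa [(hzo.2 hp).1 z (hzs.trans hzf)] at hD
    have hctrl : ∀ n, ∀ z ∈ Z, f^[n] z ∈ C → z ∈ ⋃ k, E.controlStep μ C k := by
      intro n
      induction n with
      | zero => exact fun z _ hz => E.subset_iUnion_controlStep μ C hz
      | succ n ih =>
        intro z hz hzC
        by_cases hzs : μ z = fav z
        · exact hstep z hz hzs (ih (f z) (hZf z hz) hzC)
        · exact E.subset_iUnion_controlStep μ C ⟨hz, hzs⟩
    have hctrl' : ∀ z ∈ Z, z ∈ ⋃ k, E.controlStep μ C k := by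
      intro z hz
      obtain ⟨n, hn⟩ := hZtrans z hz c₀ hc₀Z
      exact hctrl n z hz (hn ▸ ⟨hc₀Z, hc₀⟩)
    have hfavinj : ∀ z ∈ Z, ∀ w ∈ Z, ∀ o, fav z = some o → fav w = some o → z = w := by
      intro z hz w hw o hzo hwo
      have h1 := (hf z (hZJ z hz)).2.2 o hzo
      have h2 := (hf w (hZJ w hw)).2.2 o hwo
      by_cases hp : ∃ p ∈ J, E.owners o = {p}
      · obtain ⟨p, hpJ, hp⟩ := hp
        exact hZinj z hz w hw ((h1.1 p hpJ hp).trans (h2.1 p hpJ hp).symm)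
      · push Not at hp
        by_cases hu : ∃ u, μ u = some o
        · obtain ⟨u, hu⟩ := hu
          exact hZinj z hz w hw (((h1.2 hp).1 u hu).trans ((h2.2 hp).1 u hu).symm)
        · push Not at hu
          exact (hZfix z hz ((h1.2 hp).2 hu) w hw).symm
    -- The orbit obtains its favorites and displaced outsiders get the null object. A displaced
    -- outsider held an object whose private owner lies in `Z`; otherwise she would be a successor
    -- and lie in `Z` herself.
    set σ : I → Option O := fun w =>
      if w ∈ Z then fav w else if ∃ z ∈ Z, fav z = μ w then none else μ w with hσ
    have hσZ : ∀ z ∈ Z, σ z = fav z := fun z hz => if_pos hz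
    have hσ' : ∀ w, w ∉ Z → ∀ o, σ w = some o → μ w = some o ∧ ∀ z ∈ Z, fav z ≠ some o := by
      intro w hw o ho
      simp only [hσ, if_neg hw] at ho
      split_ifs at ho with hex
      exact ⟨ho, fun z hz hzo => hex ⟨z, hz, hzo.trans ho.symm⟩⟩
    refine hμ.2 ⟨C, σ, ⟨c₀, hc₀Z, hc₀⟩, ?_, ?_, ?_⟩
    · intro i j o hi hj
      by_cases hiZ : i ∈ Z <;> by_cases hjZ : j ∈ Z
      · exact hfavinj i hiZ j hjZ o (hσZ i hiZ ▸ hi) (hσZ j hjZ ▸ hj)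
      · exact absurd (hσZ i hiZ ▸ hi) ((hσ' j hjZ o hj).2 i hiZ)
      · exact absurd (hσZ j hjZ ▸ hj) ((hσ' i hiZ o hi).2 j hjZ)
      · exact hμ.1 i j o (hσ' i hiZ o hi).1 (hσ' j hjZ o hj).1
    · rintro z ⟨hz, hne⟩
      rw [hσZ z hz]
      exact hμfav z (hZJ z hz) hne
    · intro w hw
      have hwZ : w ∉ Z := by
        intro hwZ
        rw [hσZ w hwZ] at hw
        by_cases hne : μ w = fav w
        · rw [hne] at hw
          exact E.pref_irrefl _ _ hw
        · exact E.pref_asymm hw (hμfav w (hZJ w hwZ) hne)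
      have hex : ∃ z ∈ Z, fav z = μ w := by
        by_contra hex
        simp only [hσ, if_neg hwZ, if_neg hex] at hw
        exact E.pref_irrefl _ _ hw
      obtain ⟨z, hz, hzw⟩ := hex
      rcases hwo : μ w with _ | o
      · simp only [hσ, if_neg hwZ, hwo] at hw
        split_ifs at hw <;> exact absurd hw (E.pref_irrefl _ _)
      · rw [hwo] at hzw
        have hzo := (hf z (hZJ z hz)).2.2 o hzw
        by_cases hp : ∃ p ∈ J, E.owners o = {p}
        · obtain ⟨p, hpJ, hp⟩ := hp
          refine ⟨o, ?_, rfl⟩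
          rw [control, endow, Set.mem_ofPred_eq, hp, Set.singleton_subset_iff,
            ← hzo.1 p hpJ hp]
          exact hctrl' _ (hZf z hz)
        · push Not at hp
          have : f z = w := (hzo.2 hp).1 w hwo
          exact absurd (this ▸ hZf z hz) hwZ

/-- The agents in `l`, in this order, leave with their assignments in `μ`, one by one or in
trading cycles of private owners, and everybody obtains a favorite remaining object. -/
inductive Decomposition (E : Economy I O) (μ : I → Option O) : List I → Prop
  | nil : Decomposition E μ []
  | single (i : I) (l : List I) (hi : i ∉ l)
      (hfav : E.IsFavorite i (avail μ {j | j ∈ i :: l}) (μ i))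
      (hown : ∀ o p, μ i = some o → E.owners o = {p} → p ∉ l) (hl : Decomposition E μ l) :
      Decomposition E μ (i :: l)
  | cycle (f : I → I) (x : I) (c l : List I) (hx : x ∈ Function.periodicPts f)
      (hc : ∀ j, j ∈ c ↔ ∃ n, f^[n] x = j) (hhead : c.head? = some x) (hcn : c.Nodup)
      (hcl : ∀ j ∈ c, j ∉ l)
      (hfav : ∀ j ∈ c, ∃ o, μ j = some o ∧ E.owners o = {f j} ∧
        E.IsFavorite j (avail μ {j | j ∈ c ++ l}) (some o)) (hl : Decomposition E μ l) :
      Decomposition E μ (c ++ l)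

theorem Decomposition.nodup {E : Economy I O} {μ : I → Option O} {l : List I}
    (h : Decomposition E μ l) : l.Nodup := by
  induction h with
  | nil => exact List.nodup_nil
  | single i l hi _ _ _ ih => exact List.nodup_cons.2 ⟨hi, ih⟩
  | cycle f x c l _ _ _ hcn hcl _ _ ih =>
    refine List.nodup_append'.2 ⟨hcn, ih, fun a ha ha' => hcl a ha ha'⟩

theorem exists_cycleList {α : Type*} {f : α → α} {x : α} (hx : x ∈ Function.periodicPts f) :
    ∃ c : List α, (∀ j, j ∈ c ↔ ∃ n, f^[n] x = j) ∧ c.head? = some x ∧ c.Nodup := by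
  have hpos := Function.minimalPeriod_pos_of_mem_periodicPts hx
  refine ⟨(List.range (Function.minimalPeriod f x)).map fun n => f^[n] x, ?_, ?_, ?_⟩
  · intro j
    simp only [List.mem_map, List.mem_range]
    refine ⟨fun ⟨n, _, h⟩ => ⟨n, h⟩, fun ⟨n, h⟩ =>
      ⟨n % Function.minimalPeriod f x, Nat.mod_lt _ hpos, ?_⟩⟩
    rw [Function.iterate_mod_minimalPeriod_eq, h]
  · obtain ⟨m, hm⟩ := Nat.exists_eq_succ_of_ne_zero hpos.ne'
    rw [hm, List.range_succ_eq_map]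
    rfl
  · refine List.Nodup.map_on ?_ List.nodup_range
    intro a ha b hb hab
    exact Function.iterate_injOn_Iio_minimalPeriod (List.mem_range.1 ha) (List.mem_range.1 hb) hab

/-- Peel off one group and recurse on the smaller set of agents. The same unblocked `μ` serves at
every stage, since only the available objects change. -/
theorem exists_decomposition [Finite I] [Finite O] {E : Economy I O}
    {μ : I → Option O} (hμ : μ ∈ E.exclusionCore) (J : Set I) :
    ∃ l : List I, Decomposition E μ l ∧ {j | j ∈ l} = J := by
  induction J using WellFoundedLT.induction with
  | _ J ih =>
    rcases J.eq_empty_or_nonempty with rfl | hJ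
    · exact ⟨[], .nil, by simp⟩
    rcases exists_single_or_cycle hμ hJ with ⟨i, hi, hfav, hown⟩ | ⟨f, x, hx, hcyc⟩
    · obtain ⟨l, hl, hlJ⟩ := ih (J \ {i}) (Set.sdiff_singleton_ssubset.2 hi)
      have hmem : ∀ j, j ∈ l ↔ j ∈ J ∧ j ≠ i := fun j => Set.ext_iff.1 hlJ j
      have hJ' : {j | j ∈ i :: l} = J := by
        ext j
        by_cases h : j = i <;> simp [hmem, h, hi]
      refine ⟨i :: l, .single i l (fun h => ((hmem i).1 h).2 rfl) (hJ'.symm ▸ hfav) ?_ hl, hJ'⟩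
      exact fun o p ho hp hpl => ((hmem p).1 hpl).2 (hown o p ho hp ((hmem p).1 hpl).1)
    · obtain ⟨c, hc, hhead, hcn⟩ := exists_cycleList hx
      have hcJ : ∀ j ∈ c, j ∈ J := fun j hj => by
        obtain ⟨n, rfl⟩ := (hc j).1 hj
        exact (hcyc n).1
      obtain ⟨l, hl, hlJ⟩ := ih (J \ {j | j ∈ c}) (by
        refine ssubset_iff_subset_not_subset.2 ⟨Set.sdiff_subset, fun h => ?_⟩
        exact (h (hcyc 0).1).2 ((hc _).2 ⟨0, rfl⟩))
      have hmem : ∀ j, j ∈ l ↔ j ∈ J ∧ j ∉ c := fun j => Set.ext_iff.1 hlJ j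
      have hJ' : {j | j ∈ c ++ l} = J := by
        ext j
        have := hcJ j
        simp only [Set.mem_ofPred_eq, List.mem_append, hmem]
        tauto
      refine ⟨c ++ l, .cycle f x c l hx hc hhead hcn
        (fun j hj hjl => ((hmem j).1 hjl).2 hj) ?_ hl, hJ'⟩
      intro j hj
      obtain ⟨n, rfl⟩ := (hc j).1 hj
      rw [hJ']
      exact (hcyc n).2

/-! ### Replaying one trading cycle, request by request -/

theorem cycleAgents_eq_range {s : YState I O} {f : I → I} {x i : I}
    (hx : x ∈ Function.periodicPts f)
    (hlink : ∀ j k, link s j k ↔ j ∈ Set.range (fun n => f^[n] x) ∧ k = f j)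
    (hi : i ∈ Set.range fun n => f^[n] x) :
    cycleAgents s i = Set.range fun n => f^[n] x := by
  have hgen : ∀ n, ∀ j ∈ Set.range (fun n => f^[n] x),
      Relation.TransGen (link s) j (f^[n + 1] j) := by
    intro n j hj
    obtain ⟨m, rfl⟩ := hj
    induction n with
    | zero => exact .single ((hlink _ _).2 ⟨⟨m, rfl⟩, rfl⟩)
    | succ n ih =>
      refine ih.tail ((hlink _ _).2 ⟨⟨n + 1 + m, ?_⟩, ?_⟩)
      · exact Function.iterate_add_apply f (n + 1) m x
      · exact Function.iterate_succ_apply' f (n + 1) _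
  have htrans : ∀ j ∈ Set.range (fun n => f^[n] x), ∀ k ∈ Set.range (fun n => f^[n] x),
      Relation.TransGen (link s) j k := by
    rintro _ ⟨m, rfl⟩ _ ⟨n, rfl⟩
    obtain ⟨k, hk⟩ := exists_iterate_eq_of_mem_periodicPts hx (m + 1)
    have h := hgen (n + k) (f^[m] x) ⟨m, rfl⟩
    rwa [show f^[n + k + 1] (f^[m] x) = f^[n] x by
      rw [Function.iterate_succ_apply,
        show f (f^[m] x) = f^[m + 1] x from (Function.iterate_succ_apply' f m x).symm,
        Function.iterate_add_apply, hk]] at h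
  ext j
  constructor
  · rintro ⟨-, h⟩
    rcases Relation.TransGen.head'_iff.1 h with ⟨k, hk, -⟩
    exact ((hlink j k).1 hk).1
  · exact fun hj => ⟨htrans i hi j hj, htrans j hj i hi⟩

open Classical in
/-- The state `s'` after `n` agents of the cycle starting at `x` have requested objects, starting
from the state `s`. -/
structure AfterRequests (μ : I → Option O) (f : I → I) (x : I) (s : YState I O) (n : ℕ)
    (s' : YState I O) : Prop where
  fresh : Fresh s'
  head : s'.order.head? = some (f^[n] x)
  mem : ∀ j, j ∈ s'.order ↔ j ∈ s.order
  filter : s'.order.filter (fun j => decide (j ∉ Set.range fun n => f^[n] x)) =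
    s.order.filter (fun j => decide (j ∉ Set.range fun n => f^[n] x))
  objs : s'.objs = s.objs
  objArc : s'.objArc = s.objArc
  shared : s'.shared = s.shared
  result : s'.result = s.result
  arc : ∀ k < n, s'.agentArc (f^[k] x) = μ (f^[k] x)
  arc_none : ∀ j, (∀ k < n, f^[k] x ≠ j) → s'.agentArc j = none

theorem AfterRequests.step {E : Economy I O} {r : List I} {μ : I → Option O} {f : I → I} {x : I}
    {s s' : YState I O} {n : ℕ} (h : AfterRequests μ f x s n s')
    (hn : n + 1 < Function.minimalPeriod f x) (hmem : ∀ n, f^[n] x ∈ s.order)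
    (hz : ∀ n, ∃ o, μ (f^[n] x) = some o ∧ E.IsFavorite (f^[n] x) s.objs (some o) ∧
      s.objArc o = some (f (f^[n] x))) :
    ∃ s'', E.YStep r s' s'' ∧ AfterRequests μ f x s (n + 1) s'' := by
  classical
  obtain ⟨o, hμo, hfav, harc⟩ := hz n
  have hne : ∀ k < n + 1, f^[k] x ≠ f^[n + 1] x := fun k hk he =>
    hk.ne (Function.iterate_injOn_Iio_minimalPeriod (hk.trans hn) hn he)
  have hfi : f (f^[n] x) = f^[n + 1] x := (Function.iterate_succ_apply' f n x).symm
  rw [hfi] at harc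
  have hk : f^[n + 1] x ∈ s'.order := (h.mem _).2 (hmem _)
  have hi : f^[n] x ∈ s'.order := (h.mem _).2 (hmem _)
  have hfp : Fresh (pointTo s' (f^[n] x) o) :=
    fresh_pointTo h.fresh hi (h.objs ▸ hfav.1 o rfl)
  refine ⟨moveTop (pointTo s' (f^[n] x) o) (f^[n + 1] x), ?_, ?_⟩
  · rw [YStep, h.fresh.refresh_eq]
    -- No cycle closes yet: the path from the requester leads to the next agent of the orbit, who
    -- has not requested and so has no arc.
    refine YAct.move s' _ o _ h.head (h.objs ▸ hfav) (h.objArc ▸ harc) ?_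
    rintro ⟨hc, -⟩
    obtain ⟨k, hk1, hk2⟩ := Relation.TransGen.head'_iff.1 hc
    obtain rfl : f^[n + 1] x = k :=
      link_unique ⟨o, pointTo_agentArc_self .., by rw [← harc, ← h.objArc]; rfl⟩ hk1
    rcases Relation.ReflTransGen.cases_head_iff.1 hk2 with he | ⟨w, ⟨o', hw, -⟩, -⟩
    · exact hne n (Nat.lt_succ_self n) he.symm
    · rw [pointTo_agentArc_of_ne (hne n (Nat.lt_succ_self n)).symm,
        h.arc_none _ fun k hk => hne k (hk.trans (Nat.lt_succ_self n))] at hw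
      cases hw
  · refine ⟨fresh_moveTop hfp hk, rfl, fun j => (mem_moveTop hk j).trans (h.mem j), ?_, h.objs,
      h.objArc, h.shared, h.result, ?_, ?_⟩
    · rw [← h.filter]
      simp only [moveTop, pointTo]
      rw [List.filter_cons_of_neg (by simpa using ⟨n + 1, rfl⟩), List.filter_filter]
      refine List.filter_congr fun j _ => ?_
      rw [Bool.eq_iff_iff]
      simp only [Bool.and_eq_true, decide_eq_true_eq]
      exact and_iff_left_of_imp fun h' he => h' ⟨n + 1, he.symm⟩
    · intro k hk
      by_cases he : f^[k] x = f^[n] x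
      · rw [he, hμo]
        exact pointTo_agentArc_self ..
      · have hkn : k < n := lt_of_le_of_ne (Nat.lt_succ_iff.1 hk) fun h' => he (by rw [h'])
        exact (pointTo_agentArc_of_ne he).trans (h.arc k hkn)
    · intro j hj
      exact (pointTo_agentArc_of_ne (hj n (Nat.lt_succ_self n)).symm).trans
        (h.arc_none j fun k hk => hj k (hk.trans (Nat.lt_succ_self n)))

/-- Some result of carrying out the cycle `Z` with the assignments `μ` in the state `s`. -/
structure AfterCycle (E : Economy I O) (μ : I → Option O) (Z : Set I) (s s' : YState I O) :
    Prop where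
  objs : s'.objs = {o ∈ s.objs | ∀ z ∈ Z, μ z ≠ some o}
  objArc : s'.objArc = s.objArc
  result : ∀ z ∈ Z, s'.result z = μ z
  result_of_notMem : ∀ z, z ∉ Z → s'.result z = s.result z
  arc_none : ∀ j, j ∉ Z → s'.agentArc j = none
  shared : ∀ a j', j' ∈ s'.shared a ↔ j' ∈ s.shared a ∨ (a ∈ s'.objs ∧ j' ∉ Z ∧
    (∃ j ∈ Z, j ∈ E.remOwners s a ∪ remShared s a) ∧
    (∃ b, (∃ z ∈ Z, μ z = some b) ∧ j' ∈ E.remOwners s b ∪ remShared s b) ∧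
    j' ∉ E.remOwners s a ∪ remShared s a)

-- Each request moves the next orbit agent to the top, and the request numbered by the minimal
-- period closes the cycle. The other agents keep their relative order throughout.
open Classical in
theorem exists_transGen_afterCycle {E : Economy I O} {r : List I} {μ : I → Option O} {f : I → I}
    {x : I} {s : YState I O} (hs : Fresh s) (harc : ∀ j, s.agentArc j = none)
    (hx : x ∈ Function.periodicPts f) (hhead : s.order.head? = some x)
    (hmem : ∀ n, f^[n] x ∈ s.order)
    (hz : ∀ n, ∃ o, μ (f^[n] x) = some o ∧ E.IsFavorite (f^[n] x) s.objs (some o) ∧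
      s.objArc o = some (f (f^[n] x))) :
    ∃ s', Relation.TransGen (E.YStep r) s s' ∧
      s'.order = s.order.filter (fun j => decide (j ∉ Set.range fun n => f^[n] x)) ∧
      E.AfterCycle μ (Set.range fun n => f^[n] x) s s' := by
  have hpos := Function.minimalPeriod_pos_of_mem_periodicPts hx
  have hmid : ∀ n, n < Function.minimalPeriod f x →
      ∃ s', Relation.ReflTransGen (E.YStep r) s s' ∧ AfterRequests μ f x s n s' := by
    intro n
    induction n with
    | zero => exact fun _ => ⟨s, .refl, hs, hhead, fun _ => Iff.rfl, rfl, rfl, rfl, rfl, rfl,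
        fun k hk => absurd hk (Nat.not_lt_zero k), fun j _ => harc j⟩
    | succ n ih =>
      intro hn
      obtain ⟨s', hr, h⟩ := ih ((Nat.lt_succ_self n).trans hn)
      obtain ⟨s'', hstep, h'⟩ := h.step (r := r) hn hmem hz
      exact ⟨s'', hr.tail hstep, h'⟩
  -- After `n`, one less than the minimal period, requests the last orbit agent is at the top; her
  -- request leads back to `x`.
  obtain ⟨n, hn⟩ := Nat.exists_eq_succ_of_ne_zero hpos.ne'
  obtain ⟨t, ht, h⟩ := hmid n (hn ▸ Nat.lt_succ_self n)
  obtain ⟨o, hμo, hfav, hobj⟩ := hz n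
  have hA : ∀ z ∈ Set.range (fun n => f^[n] x), (pointTo t (f^[n] x) o).agentArc z = μ z := by
    rintro _ ⟨k, rfl⟩
    have hk := Nat.mod_lt k hpos
    simp only
    rw [← Function.iterate_mod_minimalPeriod_eq (n := k)]
    generalize k % Function.minimalPeriod f x = k at hk
    by_cases he : f^[k] x = f^[n] x
    · rw [he, pointTo_agentArc_self, hμo]
    · rw [pointTo_agentArc_of_ne he]
      exact h.arc k (lt_of_le_of_ne (Nat.lt_succ_iff.1 (hn ▸ hk)) fun h' => he (by rw [h']))
  have hA' : ∀ z, z ∉ Set.range (fun n => f^[n] x) →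
      (pointTo t (f^[n] x) o).agentArc z = none := by
    intro z hzZ
    rw [pointTo_agentArc_of_ne fun he => hzZ ⟨n, he.symm⟩]
    exact h.arc_none z fun k _ he => hzZ ⟨k, he⟩
  have hlink : ∀ j k, link (pointTo t (f^[n] x) o) j k ↔
      j ∈ Set.range (fun n => f^[n] x) ∧ k = f j := by
    intro j k
    by_cases hj : j ∈ Set.range (fun n => f^[n] x)
    · have hj' := hA j hj
      obtain ⟨m, rfl⟩ := id hj
      obtain ⟨o', ho', -, harc'⟩ := hz m
      simp only [link, hj']
      simp only [ho', hj, true_and]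
      constructor
      · rintro ⟨_, ⟨⟩, h2⟩
        have h3 : t.objArc o' = some k := h2
        rw [h.objArc, harc'] at h3
        exact (Option.some.inj h3).symm
      · rintro rfl
        refine ⟨o', rfl, ?_⟩
        rw [← harc', ← h.objArc]
        rfl
    · simp [link, hA' j hj, hj]
  have hcyc := cycleAgents_eq_range hx hlink ⟨n, rfl⟩
  have hco : cycleObjs (pointTo t (f^[n] x) o) (f^[n] x) =
      {b | ∃ z ∈ Set.range (fun n => f^[n] x), μ z = some b} := by
    ext b
    simp only [cycleObjs, hcyc]
    exact exists_congr fun z => and_congr_right fun hzZ => by rw [hA z hzZ]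
  have hro : ∀ a, E.remOwners (pointTo t (f^[n] x) o) a = E.remOwners s a := by
    intro a
    ext j
    exact and_congr_left fun _ => h.mem j
  have hrs : ∀ a, remShared (pointTo t (f^[n] x) o) a = remShared s a := by
    intro a
    ext j
    refine and_congr (h.mem j) ?_
    rw [← h.shared]
    rfl
  have hobjs : (E.removeCycle (pointTo t (f^[n] x) o) (f^[n] x)).objs =
      {o ∈ s.objs | ∀ z ∈ Set.range (fun n => f^[n] x), μ z ≠ some o} := by
    ext b
    simp only [removeCycle, hco, ← h.objs]
    refine and_congr_right fun _ => ?_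
    simp only [Set.mem_ofPred_eq, not_exists, not_and, ne_eq]
  refine ⟨_, .tail' ht (c := E.removeCycle (pointTo t (f^[n] x) o) (f^[n] x)) ?_, ?_, hobjs,
    h.objArc, ?_, ?_, ?_, ?_⟩
  · rw [YStep, h.fresh.refresh_eq]
    refine YAct.cycle t _ o h.head (h.objs ▸ hfav) ?_ ?_
    · rw [h.objArc, hobj]
      exact Option.some_ne_none _
    · rw [hcyc]
      exact ⟨n, rfl⟩
  · simp only [removeCycle, hcyc]
    exact h.filter
  · intro z hzZ
    simp only [removeCycle, hcyc, if_pos hzZ]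
    exact hA z hzZ
  · intro z hzZ
    simp only [removeCycle, hcyc, if_neg hzZ]
    rw [← h.result]
    rfl
  · exact hA'
  · intro a j'
    rw [hobjs]
    simp only [removeCycle, hcyc, hco, hro, hrs]
    rw [show (pointTo t (f^[n] x) o).shared = s.shared from h.shared,
      show (pointTo t (f^[n] x) o).objs = s.objs from h.objs]
    simp only [Set.mem_union, Set.mem_ofPred_eq, Set.mem_sdiff, not_exists, not_and, ne_eq]

/-! ### Ownership between groups, and replaying a decomposition -/

/-- The remaining object `o` belongs to exactly one of the remaining agents `l`. -/
def IsPrivateIn (E : Economy I O) (l : List I) (s : YState I O) (o : O) : Prop :=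
  ∃ p ∈ l, E.owners o = {p} ∧ s.objArc o = some p ∧ ∀ j ∈ l, j ∉ s.shared o

/-- All remaining agents `l` own or share the object `o`, which points to the highest of them or
to an agent who has left. -/
def IsCommonIn (E : Economy I O) (l : List I) (s : YState I O) (o : O) : Prop :=
  (E.owners o = Set.univ ∨ ∀ j ∈ l, j ∉ E.owners o ∧ j ∈ s.shared o) ∧
    ∃ k, s.objArc o = some k ∧ (k ∈ l → l.head? = some k)

/-- None of the remaining agents `l` owns or shares the object `o`. -/
def IsFreeIn (E : Economy I O) (l : List I) (s : YState I O) (o : O) : Prop :=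
  (∀ j ∈ l, j ∉ E.owners o ∧ j ∉ s.shared o) ∧ ∀ k, s.objArc o = some k → k ∉ l

/-- The state `s` is reached when exactly the agents outside `l` have left with their assignments
in `μ`, and no request is pending. -/
structure BlockInv (E : Economy I O) (μ : I → Option O) (l : List I) (s : YState I O) :
    Prop where
  order : s.order = l
  objs : s.objs = avail μ {j | j ∈ l}
  result : ∀ j, j ∉ l → s.result j = μ j
  arc_none : ∀ j ∈ l, s.agentArc j = none
  status : ∀ o ∈ s.objs, E.IsPrivateIn l s o ∨ E.IsCommonIn l s o ∨ E.IsFreeIn l s o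

/-- Between groups the remaining agents form a suffix of the fixed order, so its highest eligible
agent is also the head of the current order. -/
theorem highest_suffix {r l : List I} (hr : r.Nodup) (hl : l <:+ r) {X : Set I}
    (hX : ∀ j ∈ X, j ∈ l) {k : I} (hk : l.head? = some k) (hkX : k ∈ X) :
    highest r X = some k := by
  obtain ⟨p, rfl⟩ := hl
  obtain ⟨l', rfl⟩ : ∃ l', l = k :: l' := by
    cases l with
    | nil => simp at hk
    | cons a l' => exact ⟨l', by simpa using hk⟩
  rw [highest, List.find?_append, List.find?_eq_none.2, Option.none_or,
    List.find?_cons_of_pos (by simpa using hkX)]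
  intro j hj hjX
  exact (List.nodup_append'.1 hr).2.2 hj (hX j (by simpa using hjX))

theorem BlockInv.refresh {E : Economy I O} {μ : I → Option O} {r l : List I} {s : YState I O}
    (hr : r.Nodup) (hl : l <:+ r) (hne : l ≠ []) (h : E.BlockInv μ l s) :
    E.BlockInv μ l (E.refresh r s) where
  order := h.order
  objs := h.objs
  result := h.result
  arc_none := fun j hj => by
    simp only [Economy.refresh, h.arc_none j hj, ite_self]
  status := by
    intro o ho
    obtain ⟨x, hx⟩ : ∃ x, l.head? = some x := Option.ne_none_iff_exists'.1 (by simpa using hne)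
    have hxl : x ∈ l := List.mem_of_mem_head? hx
    have hord : ∀ j, j ∈ s.order ↔ j ∈ l := fun j => by rw [h.order]
    have hkeep : ∀ k ∈ l, s.objArc o = some k → (E.refresh r s).objArc o = some k := by
      intro k hk hok
      simp only [Economy.refresh]
      rw [if_neg, hok]
      rintro ⟨k', hk', hn⟩
      rw [hok] at hk'
      cases hk'
      exact hn ((hord k).2 hk)
    rcases h.status o ho with ⟨p, hpl, hp, harc, hsh⟩ | ⟨hown, k, hk, hhead⟩ | ⟨hfree, harc⟩
    · exact Or.inl ⟨p, hpl, hp, hkeep p hpl harc, hsh⟩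
    · refine Or.inr (Or.inl ⟨hown, x, ?_, fun _ => hx⟩)
      by_cases hkl : k ∈ l
      · rw [hkeep k hkl hk, ← hhead hkl, hx]
      · simp only [Economy.refresh]
        rw [if_pos ⟨k, hk, fun hko => hkl ((hord k).1 hko)⟩]
        rcases hown with hu | hu
        · have hxo : x ∈ E.remOwners s o := ⟨(hord x).2 hxl, by simp [hu]⟩
          rw [if_pos ⟨x, hxo⟩]
          exact highest_suffix hr hl (fun j hj => (hord j).1 hj.1) hx hxo
        · rw [if_neg]
          · exact highest_suffix hr hl (fun j hj => (hord j).1 hj.1) hx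
              ⟨(hord x).2 hxl, (hu x hxl).2⟩
          · rintro ⟨j, hj⟩
            exact (hu j ((hord j).1 hj.1)).1 hj.2
    · refine Or.inr (Or.inr ⟨hfree, fun k hk hkl => ?_⟩)
      simp only [Economy.refresh] at hk
      split_ifs at hk with h1 h2
      · exact (hfree k hkl).1 (highest_mem hk).2
      · exact (hfree k hkl).2 (highest_mem hk).2
      · exact harc k hk hkl

/-- If a leading segment `c` of the remaining agents leaves with their assignments and every
remaining object either gets no new shared owner or is inherited by everybody, then the next
state satisfies the invariant. -/
theorem BlockInv.remove {E : Economy I O} {μ : I → Option O} {c l : List I} {s s' : YState I O}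
    (hcne : c ≠ []) (hcl : ∀ j ∈ c, j ∉ l) (h : E.BlockInv μ (c ++ l) s) (hs : Fresh s)
    (horder : s'.order = l) (hobjs : s'.objs = {o ∈ s.objs | ∀ z ∈ c, μ z ≠ some o})
    (hobj : s'.objArc = s.objArc) (hres : ∀ z ∈ c, s'.result z = μ z)
    (hres' : ∀ z, z ∉ c → s'.result z = s.result z)
    (harc : ∀ j, j ∉ c → s'.agentArc j = none)
    (hsh : ∀ a ∈ s'.objs, (∀ j ∈ l, j ∈ s'.shared a ↔ j ∈ s.shared a) ∨
      ((∀ j ∈ l, j ∈ s'.shared a ∨ j ∈ E.owners a) ∧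
        ∃ z ∈ c, z ∈ E.owners a ∨ z ∈ s.shared a)) :
    E.BlockInv μ l s' where
  order := horder
  objs := by
    rw [hobjs, h.objs]
    ext o
    simp only [avail, Set.mem_ofPred_eq, List.mem_append]
    constructor
    · rintro ⟨h1, h2⟩ j hj
      exact (h1 j hj).resolve_left fun hjc => h2 j hjc hj
    · intro h1
      exact ⟨fun j hj => Or.inr (h1 j hj), fun z hz hzo => hcl z hz (h1 z hzo)⟩
  result := by
    intro j hj
    by_cases hjc : j ∈ c
    · exact hres j hjc
    · rw [hres' j hjc]
      exact h.result j (by simp [hj, hjc])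
  arc_none := fun j hj => harc j fun hjc => hcl j hjc hj
  status := by
    intro a ha
    have hsha := hsh a ha
    have ha' : a ∈ s.objs := by
      rw [hobjs] at ha
      exact ha.1
    have hleft : ∀ j ∈ c, j ∈ c ++ l := fun j hj => List.mem_append_left l hj
    have hright : ∀ j ∈ l, j ∈ c ++ l := fun j hj => List.mem_append_right c hj
    rcases h.status a ha' with ⟨p, hpl, hp, hpa, hns⟩ | ⟨hown, k, hk, hhead⟩ | ⟨hfree, hfa⟩
    -- When the private owner leaves, the object becomes free if nobody inherits it and common if
    -- everybody does.
    · by_cases hpc : p ∈ c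
      · have hno : ∀ j ∈ l, j ∉ E.owners a := by
          intro j hj hja
          rw [hp, Set.mem_singleton_iff] at hja
          exact hcl p hpc (hja ▸ hj)
        rcases hsha with hsame | ⟨hall, -⟩
        · refine Or.inr (Or.inr ⟨fun j hj => ⟨hno j hj, ?_⟩, fun k hk => ?_⟩)
          · rw [hsame j hj]
            exact hns j (hright j hj)
          · rw [hobj, hpa] at hk
            cases hk
            exact hcl p hpc
        · refine Or.inr (Or.inl ⟨Or.inr fun j hj => ⟨hno j hj,
            (hall j hj).resolve_right (hno j hj)⟩, p, by rw [hobj, hpa], ?_⟩)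
          exact fun hpl => absurd hpl (hcl p hpc)
      · have hpl' : p ∈ l := (List.mem_append.1 hpl).resolve_left hpc
        rcases hsha with hsame | ⟨-, z, hz, hz' | hz'⟩
        · refine Or.inl ⟨p, hpl', hp, by rw [hobj, hpa], fun j hj => ?_⟩
          rw [hsame j hj]
          exact hns j (hright j hj)
        · rw [hp, Set.mem_singleton_iff] at hz'
          exact absurd (hz' ▸ hz) hpc
        · exact absurd hz' (hns z (hleft z hz))
    -- A common object points to the head of the order, who is in the leaving group; the next
    -- refresh redirects it to the new head.
    · have hkc : k ∈ c := by
        have hk' := hhead (h.order ▸ hs.obj a k hk)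
        cases c with
        | nil => exact absurd rfl hcne
        | cons i c =>
          obtain rfl : i = k := by simpa using hk'
          exact List.mem_cons_self
      refine Or.inr (Or.inl ⟨?_, k, by rw [hobj, hk], fun hkl => absurd hkl (hcl k hkc)⟩)
      refine hown.imp_right fun hall j hj => ⟨(hall j (hright j hj)).1, ?_⟩
      rcases hsha with hsame | ⟨hall', -⟩
      · rw [hsame j hj]
        exact (hall j (hright j hj)).2
      · exact (hall' j hj).resolve_right (hall j (hright j hj)).1
    · refine Or.inr (Or.inr ⟨fun j hj => ⟨(hfree j (hright j hj)).1, ?_⟩, fun k hk hkl => ?_⟩)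
      · rcases hsha with hsame | ⟨-, z, hz, hz'⟩
        · rw [hsame j hj]
          exact (hfree j (hright j hj)).2
        · exact absurd hz' (not_or.2 (hfree z (hleft z hz)))
      · rw [hobj] at hk
        exact hfa k hk (hright k hkl)

/-- Inheritance is all or nothing. If the cycle contains a common object, all remaining agents have
a stake in it and inherit whatever the cycle agents owned or shared. Otherwise its objects are
private to cycle agents, since free ones point to nobody remaining, and no other agent qualifies. -/
theorem BlockInv.afterCycle {E : Economy I O} {μ : I → Option O} {c l : List I}
    {s s' : YState I O} (hcne : c ≠ []) (hcl : ∀ j ∈ c, j ∉ l) (h : E.BlockInv μ (c ++ l) s)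
    (hs : Fresh s)
    (hz : ∀ z ∈ c, ∃ o, μ z = some o ∧ o ∈ s.objs ∧ ∃ w ∈ c, s.objArc o = some w)
    (horder : s'.order = l) (hc : E.AfterCycle μ {j | j ∈ c} s s') : E.BlockInv μ l s' := by
  refine h.remove hcne hcl hs horder hc.objs hc.objArc hc.result hc.result_of_notMem
    hc.arc_none ?_
  intro a ha
  have hord : ∀ j, j ∈ s.order ↔ j ∈ c ∨ j ∈ l := fun j => by rw [h.order, List.mem_append]
  by_cases hinh : (∃ b, (∃ z ∈ c, μ z = some b) ∧ E.IsCommonIn (c ++ l) s b) ∧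
      ∃ j ∈ c, j ∈ E.remOwners s a ∪ remShared s a
  · obtain ⟨⟨b, hb, hown, -⟩, j₀, hj₀, hj₀a⟩ := hinh
    refine Or.inr ⟨fun j hj => ?_, j₀, hj₀, hj₀a.imp (fun h => h.2) fun h => h.2⟩
    have hjo : j ∈ s.order := (hord j).2 (Or.inr hj)
    by_cases hja : j ∈ E.remOwners s a ∪ remShared s a
    · rcases hja with hja | hja
      · exact Or.inr hja.2
      · exact Or.inl ((hc.shared a j).2 (Or.inl hja.2))
    · refine Or.inl ((hc.shared a j).2 (Or.inr ⟨ha, fun hjc => hcl j hjc hj, ⟨j₀, hj₀, hj₀a⟩,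
        ⟨b, hb, ?_⟩, hja⟩))
      rcases hown with hu | hu
      · exact Or.inl ⟨hjo, by simp [hu]⟩
      · exact Or.inr ⟨hjo, (hu j (List.mem_append_right c hj)).2⟩
  · refine Or.inl fun j hj => ⟨fun hja => ?_, fun hja => (hc.shared a j).2 (Or.inl hja)⟩
    rcases (hc.shared a j).1 hja with hja | ⟨-, -, hex, ⟨b, ⟨z, hzc, hzb⟩, hjb⟩, -⟩
    · exact hja
    · exfalso
      obtain ⟨o, ho, hob, w, hw, hwo⟩ := hz z hzc
      have hzb' : μ z = some b := hzb
      obtain rfl : o = b := by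
        rw [hzb'] at ho
        exact (Option.some.inj ho).symm
      have hjr := List.mem_append_right c hj
      rcases h.status o hob with ⟨p, hpl, hp, hpa, hns⟩ | hcom | ⟨hfree, -⟩
      · rw [hpa] at hwo
        cases hwo
        rcases hjb with hjb | hjb
        · have := hjb.2
          rw [hp, Set.mem_singleton_iff] at this
          exact hcl w hw (this ▸ hj)
        · exact hns j hjr hjb.2
      · exact hinh ⟨⟨o, ⟨z, hzc, hzb'⟩, hcom⟩, hex⟩
      · rcases hjb with hjb | hjb
        · exact (hfree j hjr).1 hjb.2
        · exact (hfree j hjr).2 hjb.2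

theorem BlockInv.exists_cycle {E : Economy I O} {μ : I → Option O} {r : List I} {f : I → I}
    {x : I} {c l : List I} {s : YState I O} (hr : r.Nodup) (hl : c ++ l <:+ r)
    (h : E.BlockInv μ (c ++ l) s) (hx : x ∈ Function.periodicPts f)
    (hc : ∀ j, j ∈ c ↔ ∃ n, f^[n] x = j) (hhead : c.head? = some x) (hcl : ∀ j ∈ c, j ∉ l)
    (hz : ∀ z ∈ c, ∃ o, μ z = some o ∧ E.IsFavorite z (avail μ {j | j ∈ c ++ l}) (some o) ∧
      (E.refresh r s).objArc o = some (f z)) :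
    ∃ s', Relation.ReflTransGen (E.YStep r) s s' ∧ E.BlockInv μ l s' := by
  have hcne : c ≠ [] := by
    rintro rfl
    simp at hhead
  have hf := E.fresh_refresh r s
  have ht := h.refresh hr hl (by simp [hcne])
  have hstep : ∀ s', Relation.TransGen (E.YStep r) (E.refresh r s) s' →
      Relation.ReflTransGen (E.YStep r) s s' := by
    intro s' hs'
    obtain ⟨a, ha, has⟩ := Relation.TransGen.head'_iff.1 hs'
    refine .head ?_ has
    rwa [YStep, hf.refresh_eq] at ha
  generalize E.refresh r s = t at hf ht hstep hz
  have hZ : (Set.range fun n => f^[n] x) = {j | j ∈ c} := by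
    ext j
    exact (hc j).symm
  have hcx : ∀ n, f^[n] x ∈ c := fun n => (hc _).2 ⟨n, rfl⟩
  have harc : ∀ j, t.agentArc j = none := by
    intro j
    rcases hj : t.agentArc j with _ | o
    · rfl
    · rw [← hj]
      exact ht.arc_none j (ht.order ▸ (hf.agent j o hj).1)
  obtain ⟨s', hs', horder, hafter⟩ := exists_transGen_afterCycle (r := r) (E := E) (μ := μ) hf
    harc hx (by rw [ht.order, List.head?_append, hhead]; rfl)
    (fun n => by rw [ht.order]; exact List.mem_append_left l (hcx n))
    (fun n => by rw [ht.objs]; exact hz _ (hcx n))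
  rw [hZ] at hafter
  refine ⟨s', hstep s' hs', ht.afterCycle hcne hcl hf ?_ ?_ hafter⟩
  · intro z hzc
    obtain ⟨o, ho, hfav, hoa⟩ := hz z hzc
    obtain ⟨n, rfl⟩ := (hc z).1 hzc
    exact ⟨o, ho, ht.objs ▸ hfav.1 o rfl, _,
      (hc _).2 ⟨n + 1, Function.iterate_succ_apply' f n x⟩, hoa⟩
  · rw [horder, hZ, ht.order, List.filter_append, List.filter_eq_nil_iff.2, List.nil_append,
      List.filter_eq_self.2]
    · intro j hj
      have : j ∉ c := fun hjc => hcl j hjc hj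
      simpa using this
    · intro j hj
      simpa using hj

/-- If the favorite of `i` points to anyone, it is to `i` herself: she is its remaining private
owner, or it is common and points to the head. Then she leaves by a cycle of length one, which may
trigger inheritance. -/
theorem BlockInv.exists_single {E : Economy I O} {μ : I → Option O} {r : List I} {i : I}
    {l : List I} {s : YState I O} (hr : r.Nodup) (hl : i :: l <:+ r)
    (h : E.BlockInv μ (i :: l) s) (hi : i ∉ l)
    (hfav : E.IsFavorite i (avail μ {j | j ∈ i :: l}) (μ i))
    (hown : ∀ o p, μ i = some o → E.owners o = {p} → p ∉ l) :
    ∃ s', Relation.ReflTransGen (E.YStep r) s s' ∧ E.BlockInv μ l s' := by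
  have hf := E.fresh_refresh r s
  have ht := h.refresh hr hl (by simp)
  have hsingle : E.BlockInv μ l (removeSingle (E.refresh r s) i (μ i)) := by
    refine BlockInv.remove (c := [i]) (by simp) (by simpa using hi) ht hf ?_ ?_ rfl ?_ ?_ ?_ ?_
    · simp only [removeSingle, ht.order]
      rw [List.filter_cons_of_neg (by simp), List.filter_eq_self.2]
      intro j hj
      simpa using fun he : j = i => hi (he ▸ hj)
    · simp [removeSingle]
    · simp [removeSingle]
    · intro z hz
      have hzi : z ≠ i := by simpa using hz
      simp [removeSingle, hzi]
    · intro j hj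
      rcases hja : (E.refresh r s).agentArc j with _ | o
      · exact hja
      · refine absurd (ht.arc_none j ?_) (by simp [hja])
        have := (hf.agent j o hja).1
        rwa [ht.order] at this
    · exact fun a _ => Or.inl fun j _ => Iff.rfl
  have hhead : (E.refresh r s).order.head? = some i := by
    rw [ht.order]
    rfl
  rcases hμi : μ i with _ | o
  · rw [hμi] at hsingle hfav
    exact ⟨_, .single (YAct.null _ i hhead (ht.objs ▸ hfav)), hsingle⟩
  · rcases harc : (E.refresh r s).objArc o with _ | k
    · rw [hμi] at hsingle hfav
      exact ⟨_, .single (YAct.direct _ i o hhead (ht.objs ▸ hfav) harc), hsingle⟩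
    · have hk : k ∈ i :: l := ht.order ▸ hf.obj o k harc
      have hki : k = i := by
        have hos : o ∈ (E.refresh r s).objs := ht.objs ▸ hfav.1 o hμi
        rcases ht.status o hos with ⟨p, hpl, hp, hpa, -⟩ | ⟨-, k', hk', hh⟩ | ⟨-, hfa⟩
        · rw [harc] at hpa
          cases hpa
          exact (List.mem_cons.1 hk).resolve_right (hown o k hμi hp)
        · rw [harc] at hk'
          cases hk'
          exact (Option.some.inj (hh hk)).symm
        · exact absurd hk (hfa k harc)
      subst hki
      refine BlockInv.exists_cycle (c := [k]) (f := id) (x := k) hr hl h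
        (Function.mk_mem_periodicPts Nat.one_pos rfl) (fun j => by simp [eq_comm]) rfl
        (by simpa using hi) ?_
      intro z hz
      obtain rfl : z = k := by simpa using hz
      exact ⟨o, hμi, hμi ▸ hfav, harc⟩

theorem Decomposition.exists_run {E : Economy I O} {μ : I → Option O} {r l : List I}
    (hr : r.Nodup) (h : Decomposition E μ l) : l <:+ r → ∀ s, E.BlockInv μ l s →
      ∃ s', Relation.ReflTransGen (E.YStep r) s s' ∧ s'.order = [] ∧ s'.result = μ := by
  induction h with
  | nil => exact fun _ s hs => ⟨s, .refl, hs.order, funext fun j => hs.result j (by simp)⟩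
  | single i l hi hfav hown _ ih =>
    intro hl s hs
    obtain ⟨s', hs', hinv⟩ := hs.exists_single hr hl hi hfav hown
    obtain ⟨s'', h1, h2⟩ := ih ((List.suffix_cons i l).trans hl) s' hinv
    exact ⟨s'', hs'.trans h1, h2⟩
  | cycle f x c l hx hc hhead hcn hcl hfav _ ih =>
    intro hl s hs
    have hne : c ++ l ≠ [] := by
      intro he
      rw [(List.append_eq_nil_iff.1 he).1] at hhead
      cases hhead
    obtain ⟨s', hs', hinv⟩ := hs.exists_cycle hr hl hx hc hhead hcl (fun z hz => by
      obtain ⟨o, ho, hp, hfo⟩ := hfav z hz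
      refine ⟨o, ho, hfo, ?_⟩
      have ht := hs.refresh hr hl hne
      have hfz : f z ∈ c ++ l := by
        obtain ⟨n, rfl⟩ := (hc z).1 hz
        exact List.mem_append_left l ((hc _).2 ⟨n + 1, Function.iterate_succ_apply' f n x⟩)
      rcases ht.status o (ht.objs ▸ hfo.1 o rfl) with ⟨p, -, hp', hpa, -⟩ | ⟨hu, k, hk, hh⟩ |
        ⟨hfree, -⟩
      · rw [hp] at hp'
        rw [hpa, Set.singleton_injective hp']
      · rcases hu with hu | hu
        -- Here `o` is both private and public, so its owner is the only agent.
        · have hk' := (E.fresh_refresh r s).obj o k hk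
          have : k ∈ E.owners o := by simp [hu]
          rw [hp, Set.mem_singleton_iff] at this
          rw [hk, this]
        · exact absurd (by simp [hp]) (hu (f z) hfz).1
      · exact absurd (by simp [hp]) (hfree (f z) hfz).1)
    obtain ⟨s'', h1, h2⟩ := ih ((List.suffix_append c l).trans hl) s' hinv
    exact ⟨s'', hs'.trans h1, h2⟩

theorem blockInv_init {E : Economy I O} (hE : E.PrivatePublic) (μ : I → Option O) {r : List I}
    (hr : ∀ i, i ∈ r) : E.BlockInv μ r (E.yInit r) where
  order := rfl
  objs := by
    ext o
    simp [yInit, avail, hr]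
  result := fun j hj => absurd (hr j) hj
  arc_none := fun _ _ => rfl
  status := by
    intro o _
    rcases hE o with ⟨p, hp⟩ | hu
    · refine Or.inl ⟨p, hr p, hp, ?_, fun _ _ h => h⟩
      simp only [yInit, hp]
      exact highest_singleton (hr p)
    · obtain ⟨i, -⟩ := E.owners_nonempty o
      have hne : r ≠ [] := List.ne_nil_of_mem (hr i)
      obtain ⟨x, hx⟩ : ∃ x, r.head? = some x := Option.ne_none_iff_exists'.1 (by simpa using hne)
      refine Or.inr (Or.inl ⟨Or.inl hu, x, ?_, fun _ => hx⟩)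
      cases r with
      | nil => exact absurd rfl hne
      | cons y r =>
        cases hx
        simp only [yInit, hu, highest]
        exact List.find?_cons_of_pos (by simp)

theorem exclusionCore_subset_yrmhOutcomes [Finite I] [Finite O] {E : Economy I O}
    (hE : E.PrivatePublic) : E.exclusionCore ⊆ E.yrmhOutcomes := by
  intro μ hμ
  obtain ⟨r, hdec, hmem⟩ := exists_decomposition hμ Set.univ
  have hr : ∀ i, i ∈ r := fun i => Set.ext_iff.1 hmem i |>.2 (Set.mem_univ i)
  obtain ⟨s, hs, hend, hres⟩ :=
    hdec.exists_run hdec.nodup List.suffix_rfl _ (blockInv_init hE μ hr)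
  exact ⟨r, hdec.nodup, hr, s, hs, hend, hres⟩

/-! ### Closing the circle of inclusions -/

theorem yrmhOutcomes_eq_cores [Finite I] [Finite O] {E : Economy I O} (hE : E.PrivatePublic) :
    E.yrmhOutcomes = E.refinedExclusionCore ∧ E.refinedExclusionCore = E.exclusionCore ∧
      E.exclusionCore ⊆ E.rectifiedCore := by
  have h1 : E.yrmhOutcomes ⊆ E.refinedExclusionCore := fun μ hμ => by
    obtain ⟨τ, hτ⟩ := exists_isRanking_of_mem_yrmhOutcomes hμ
    exact hτ.mem_refinedExclusionCore hE
  have h2 := E.refinedExclusionCore_subset_exclusionCore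
  have h3 := exclusionCore_subset_yrmhOutcomes hE
  refine ⟨h1.antisymm (h2.trans h3), h2.antisymm (h3.trans h1), fun μ hμ => ?_⟩
  obtain ⟨τ, hτ⟩ := exists_isRanking_of_mem_yrmhOutcomes (h3 hμ)
  exact hτ.mem_rectifiedCore hE

/-! ### An economy that separates the strong core -/

/-- The rank of an assignment in the preferences of an agent of the four-agent economy: agents
`0` and `3` rank `false`, null, `true`, and agents `1` and `2` rank `true`, null, `false`. -/
def fourAgentRank (i : Fin 4) : Option Bool → ℕ
  | none => 1
  | some b => if b = (i = 1 ∨ i = 2 : Bool) then 0 else 2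

theorem fourAgentRank_injective : ∀ i, Function.Injective (fourAgentRank i) := by
  unfold Function.Injective
  decide

/-- An economy in which agent `0` owns the object `true` and the object `false` is public. -/
def fourAgentEconomy : Economy (Fin 4) Bool where
  pref i a b := fourAgentRank i a < fourAgentRank i b
  pref_strictTotal i :=
    (⟨⟨fourAgentRank i, fourAgentRank_injective i⟩, Iff.rfl⟩ :
      (fun a b => fourAgentRank i a < fourAgentRank i b) ↪r
        ((· < ·) : ℕ → ℕ → Prop)).isStrictTotalOrder
  owners o := {i | o = true → i = 0}
  owners_nonempty _ := ⟨0, fun _ => rfl⟩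

theorem fourAgentEconomy_privatePublic : fourAgentEconomy.PrivatePublic := by
  rintro (_ | _)
  · exact Or.inr (by ext; simp [fourAgentEconomy])
  · exact Or.inl ⟨0, by ext; simp [fourAgentEconomy]⟩

/-- A coalition containing `0` must leave her the public object, so it is everybody and `1` keeps
`true`; the objects desired by `2` and `3` are then taken. A coalition without `0` is endowed with
nothing, and null improves on nobody's assignment. -/
theorem mem_strongCore_fourAgentEconomy :
    ![some false, some true, none, none] ∈ fourAgentEconomy.strongCore := by
  refine ⟨by unfold IsAllocation; decide, ?_⟩
  rintro ⟨C, σ, -, hσ, ⟨hw, j, hjC, hj⟩, hse⟩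
  have hbest : ∀ i ∈ C, i = 0 ∨ i = 1 →
      σ i = (![some false, some true, none, none] : Fin 4 → Option Bool) i := by
    intro i hi h
    refine (hw i hi).resolve_right fun h' => ?_
    rcases h with rfl | rfl <;> exact absurd h' (Nat.not_lt_zero _)
  by_cases h0 : (0 : Fin 4) ∈ C
  · have hσ0 := hbest 0 h0 (Or.inl rfl)
    have hC : ∀ i, i ∈ C := fun i => hse 0 h0 false hσ0 (by simp [fourAgentEconomy])
    have hσ1 := hbest 1 (hC 1) (Or.inr rfl)
    have key : ∀ (j : Fin 4) (a : Option Bool), fourAgentRank j a <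
        fourAgentRank j ((![some false, some true, none, none] : Fin 4 → Option Bool) j) →
        (j = 2 ∧ a = some true) ∨ (j = 3 ∧ a = some false) := by decide
    rcases key j (σ j) hj with ⟨rfl, h⟩ | ⟨rfl, h⟩
    · exact absurd (hσ _ _ _ h hσ1) (by decide)
    · exact absurd (hσ _ _ _ h hσ0) (by decide)
  · have hnone : ∀ i ∈ C, σ i = none := by
      intro i hi
      rcases h : σ i with _ | o
      · rfl
      · exact absurd (hse i hi o h (by simp [fourAgentEconomy])) h0
    have key : ∀ j : Fin 4, fourAgentRank j none <
        fourAgentRank j ((![some false, some true, none, none] : Fin 4 → Option Bool) j) →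
        j = 0 := by decide
    have hj' : fourAgentRank j (σ j) < _ := hj
    rw [hnone j hjC] at hj'
    exact h0 (key j hj' ▸ hjC)

/-- The ranks are departure times: `3` takes the public object, the owner `0` takes null, `1` takes
the object left by `0`, and `2` finds nothing. -/
theorem isRanking_fourAgentEconomy :
    fourAgentEconomy.IsRanking ![none, some true, none, some false] ![1, 2, 3, 0] where
  alloc := by unfold IsAllocation; decide
  owner_le := by
    rintro x (_ | _) p hx hp
    · have h0 : (0 : Fin 4) ∈ ({p} : Set (Fin 4)) := hp ▸ fun _ => rfl
      have h1 : (1 : Fin 4) ∈ ({p} : Set (Fin 4)) := by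
        rw [← hp]
        exact fun h => absurd h (by decide)
      rw [Set.mem_singleton_iff] at h0 h1
      exact absurd (h0.trans h1.symm) (by decide)
    · have h0 : (0 : Fin 4) ∈ ({p} : Set (Fin 4)) := hp ▸ fun _ => rfl
      rw [Set.mem_singleton_iff] at h0
      subst h0
      revert x
      decide
  envy_lt := by
    have key : ∀ (x : Fin 4) (y : Option Bool), fourAgentRank x y < fourAgentRank x
        ((![none, some true, none, some false] : Fin 4 → Option Bool) x) →
        ∃ o j, y = some o ∧
          (![none, some true, none, some false] : Fin 4 → Option Bool) j = some o ∧
          (![1, 2, 3, 0] : Fin 4 → ℕ) j < (![1, 2, 3, 0] : Fin 4 → ℕ) x := by decide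
    exact key

/-- Agent `0`, who is indifferent, transfers her object from `1` to `2`. The rectified core
disallows this, as `{0}` is unaffected, self-enforcing and endowed with the object. -/
theorem notMem_strongCore_fourAgentEconomy :
    ![none, some true, none, some false] ∉ fourAgentEconomy.strongCore := by
  rintro ⟨-, h⟩
  refine h ⟨{0, 2}, ![none, none, some true, none], ⟨0, by simp⟩,
    by unfold IsAllocation; decide, ⟨?_, 2, by simp, ?_⟩, ?_⟩
  · rintro i (rfl | rfl)
    · exact Or.inl rfl
    · exact Or.inr (show fourAgentRank _ _ < fourAgentRank _ _ by decide)
  · exact show fourAgentRank _ _ < fourAgentRank _ _ by decide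
  · rintro i (rfl | rfl) o ho
    · exact absurd ho (by simp)
    · obtain rfl : true = o := by simpa using ho
      intro k hk
      exact Or.inl (hk rfl)

end Economy

theorem proposition5 :
    (∀ (I : Type u) (O : Type v) [Finite I] [Finite O] (E : Economy I O), E.PrivatePublic →
      E.yrmhOutcomes = E.refinedExclusionCore ∧
      E.refinedExclusionCore = E.exclusionCore ∧
      E.exclusionCore ⊆ E.rectifiedCore) ∧
    (∃ (I : Type) (O : Type) (_ : Finite I) (_ : Finite O) (E : Economy I O),
      E.PrivatePublic ∧ E.strongCore.Nonempty ∧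
      E.yrmhOutcomes ≠ E.strongCore ∧ E.refinedExclusionCore ≠ E.strongCore ∧
      E.exclusionCore ≠ E.strongCore ∧ E.rectifiedCore ≠ E.strongCore) := by
  refine ⟨fun I O _ _ E hE => Economy.yrmhOutcomes_eq_cores hE, Fin 4, Bool, inferInstance,
    inferInstance, Economy.fourAgentEconomy, Economy.fourAgentEconomy_privatePublic,
    ⟨_, Economy.mem_strongCore_fourAgentEconomy⟩, ?_⟩
  have hPP := Economy.fourAgentEconomy_privatePublic
  obtain ⟨h1, h2, -⟩ := Economy.yrmhOutcomes_eq_cores hPP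
  have href := Economy.isRanking_fourAgentEconomy.mem_refinedExclusionCore hPP
  have hrec := Economy.isRanking_fourAgentEconomy.mem_rectifiedCore hPP
  have hns := Economy.notMem_strongCore_fourAgentEconomy
  exact ⟨fun h => hns (h ▸ h1.symm ▸ href), fun h => hns (h ▸ href),
    fun h => hns (h ▸ h2 ▸ href), fun h => hns (h ▸ hrec)⟩
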